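/- For elements $s,t$ of a group put $s^t=t^{-1}st$, ${}^ts=tst^{-1}$, $[s,t]=s^{-1}t^{-1}st$. Let $\alpha,\beta\in\mathbb Z$ and let $\gamma$ be a positive integer such that $\alpha^\gamma\neq 1\neq\beta^\gamma$. Consider the Wamsley group and the Macdonald group $$W=\langle X,Y,Z\mid X^Z=X^\alpha,\ {}^ZY=Y^\beta,\ Z^\gamma=[X,Y]\rangle,\qquad G=\langle A,B\mid A^{[A,B]}=A^{\alpha^\gamma},\ {}^{[A,B]}B=B^{\beta^\gamma}\rangle,$$ which are finite, the homomorphism $\Omega:G\to W$, $A\mapsto X$, $B\mapsto Y$, and $N=\ker\Omega$. Let $p$ be a prime factor of $(\alpha^\gamma-1)(\beta^\gamma-1)$ and write $\gamma=p^nk$ with $n\ge 0$ and $p\nmid k$. Then $G$ has a unique Sylow $p$-subgroup $G_p$ and there is a unique homomorphism $\pi:G\to G_p$ that restricts to the identity on $G_p$ (the canonical projection). Put $N_p=N\cap G_p$, $q=|G/G_p|$, $a=\pi(A)$, $b=\pi(B)$, let $u,v$ be the orders of $a,b$, and put $a_0=aN_p$, $b_0=bN_p\in G_p/N_p$. The integer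 $\beta$ is invertible modulo the order of $B$, hence modulo the order of $b_0$; let $\mu$ be any integer that is inverse to $\beta$ modulo the order of $b_0$. Then: 1. $G_p$ is generated by $a,b$ subject to the defining relations $$a^{[a,b]}=a^{\alpha^\gamma},\quad b^{[b,a]}=b^{\beta^\gamma},\quad a^u=1,\quad b^v=1.$$ 2. $N_p$ is the normal closure in $G_p$ of the $\gamma-1$ elements $[a^{\alpha^i},b^{\mu^i}][a,b]^{-1}$, $1\le i\le\gamma-1$. 3. $G_p/N_p$ is generated by $a_0,b_0$ subject to the defining relations $$a_0^{[a_0,b_0]}=a_0^{\alpha^\gamma},\quad b_0^{[b_0,a_0]}=b_0^{\beta^\gamma},\quad a_0^u=1,\quad b_0^v=1,\quad [a_0^{\alpha^i},b_0^{\mu^i}]=[a_0,b_0]\ \ (1\le i\le\gamma-1).$$ 4. Let $W_p$ be a Sylow $p$-subgroup of $W$. Then $G_p/N_p$ imbeds as a normal subgroup of $W_p$ in such a way that (identifying $a_0,b_0$ with their images) $W_p/\langle a_0,b_0\rangle$ is cyclic of order $p^n$ and, for some $d_0\in W_p$, $W_p$ is generated by $a_0,b_0,d_0$ subject to the defining relations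 in 3 together with $$a_0^{d_0}=a_0^{\alpha^{qk}},\quad b_0^{d_0}=b_0^{\mu^{qk}},\quad d_0^{p^n}=[a_0,b_0]^q.$$ 5. $|W_p|=p^n|G_p|/|N_p|$. 6. If $p\nmid\gamma$, then $W$ has only one Sylow $p$-subgroup, and it is isomorphic to $G_p/N_p$. -/

import Mathlib

namespace Wamsley

section Notation

variable {H : Type*} [Group H]

/-- Right conjugation `x ^ y = y⁻¹ x y`. -/
def rconj (x y : H) : H := y⁻¹ * x * y

/-- Left conjugation `^y x = y x y⁻¹`. -/
def lconj (y x : H) : H := y * x * y⁻¹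

/-- The commutator `[x, y] = x⁻¹ y⁻¹ x y` (this is not Mathlib's `⁅x, y⁆ = x y x⁻¹ y⁻¹`). -/
def comm (x y : H) : H := x⁻¹ * y⁻¹ * x * y

/-- `H` is generated by the family `g`, subject to the defining relations `r = 1`, `r ∈ rels`:
the canonical map from the free group is onto, with kernel the normal closure of `rels`. -/
def IsPresentedBy {ι : Type*} (g : ι → H) (rels : Set (FreeGroup ι)) : Prop :=
  Function.Surjective (FreeGroup.lift g) ∧ (FreeGroup.lift g).ker = Subgroup.normalClosure rels

/-! A relation `l = r` is encoded by the relator `l * r⁻¹`. -/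

/-- `a ^ [a,b] = a ^ r`, `^[a,b] b = b ^ s`. -/
def macdonaldRelators (r s : ℤ) (a b : H) : Set H :=
  {rconj a (comm a b) * (a ^ r)⁻¹, lconj (comm a b) b * (b ^ s)⁻¹}

/-- `x ^ z = x ^ α`, `^z y = y ^ β`, `z ^ γ = [x,y]`. -/
def wamsleyRelators (α β : ℤ) (γ : ℕ) (x y z : H) : Set H :=
  {rconj x z * (x ^ α)⁻¹, lconj z y * (y ^ β)⁻¹, z ^ γ * (comm x y)⁻¹}

/-- `a ^ [a,b] = a ^ (α ^ γ)`, `b ^ [b,a] = b ^ (β ^ γ)`, `a ^ u = 1`, `b ^ v = 1`. -/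
def sylowRelators (α β : ℤ) (γ u v : ℕ) (a b : H) : Set H :=
  {rconj a (comm a b) * (a ^ (α ^ γ))⁻¹, rconj b (comm b a) * (b ^ (β ^ γ))⁻¹, a ^ u, b ^ v}

/-- The `γ - 1` elements `[a ^ (α ^ i), b ^ (μ ^ i)] [a,b]⁻¹`, `1 ≤ i ≤ γ - 1`; they are also the
relators of the relations `[a ^ (α ^ i), b ^ (μ ^ i)] = [a,b]`. -/
def commElements (α μ : ℤ) (γ : ℕ) (a b : H) : Set H :=
  {x | ∃ i : ℕ, 1 ≤ i ∧ i < γ ∧ x = comm (a ^ (α ^ i)) (b ^ (μ ^ i)) * (comm a b)⁻¹}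

/-- `a ^ d = a ^ (α ^ e)`, `b ^ d = b ^ (μ ^ e)`, `d ^ m = [a,b] ^ q`. -/
def extensionRelators (α μ : ℤ) (e m q : ℕ) (a b d : H) : Set H :=
  {rconj a d * (a ^ (α ^ e))⁻¹, rconj b d * (b ^ (μ ^ e))⁻¹, d ^ m * (comm a b ^ q)⁻¹}

end Notation

/-- The Macdonald group
`G = ⟨A, B | A ^ [A,B] = A ^ (α ^ γ), ^[A,B] B = B ^ (β ^ γ)⟩`. -/
abbrev G (α β : ℤ) (γ : ℕ) : Type :=
  PresentedGroup (macdonaldRelators (α ^ γ) (β ^ γ)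
    (FreeGroup.of (0 : Fin 2)) (FreeGroup.of (1 : Fin 2)))

/-- The Wamsley group `W = ⟨X, Y, Z | X ^ Z = X ^ α, ^Z Y = Y ^ β, Z ^ γ = [X,Y]⟩`. -/
abbrev W (α β : ℤ) (γ : ℕ) : Type :=
  PresentedGroup (wamsleyRelators α β γ
    (FreeGroup.of (0 : Fin 3)) (FreeGroup.of (1 : Fin 3)) (FreeGroup.of (2 : Fin 3)))

section Generators

variable (α β : ℤ) (γ : ℕ)

def A : G α β γ := PresentedGroup.of 0
def B : G α β γ := PresentedGroup.of 1
def X : W α β γ := PresentedGroup.of 0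
def Y : W α β γ := PresentedGroup.of 1
def Z : W α β γ := PresentedGroup.of 2

theorem X_rel : rconj (X α β γ) (Z α β γ) = X α β γ ^ α := by
  have h := PresentedGroup.one_of_mem (rels := wamsleyRelators α β γ
    (FreeGroup.of (0 : Fin 3)) (FreeGroup.of (1 : Fin 3)) (FreeGroup.of (2 : Fin 3)))
    (x := rconj (FreeGroup.of 0) (FreeGroup.of 2) * (FreeGroup.of 0 ^ α)⁻¹)
    (by simp [wamsleyRelators])
  exact mul_inv_eq_one.mp (by simpa [rconj, X, Z, PresentedGroup.of] using h)

theorem Y_rel : lconj (Z α β γ) (Y α β γ) = Y α β γ ^ β := by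
  have h := PresentedGroup.one_of_mem (rels := wamsleyRelators α β γ
    (FreeGroup.of (0 : Fin 3)) (FreeGroup.of (1 : Fin 3)) (FreeGroup.of (2 : Fin 3)))
    (x := lconj (FreeGroup.of 2) (FreeGroup.of 1) * (FreeGroup.of 1 ^ β)⁻¹)
    (by simp [wamsleyRelators])
  exact mul_inv_eq_one.mp (by simpa [lconj, Y, Z, PresentedGroup.of] using h)

theorem Z_rel : Z α β γ ^ γ = comm (X α β γ) (Y α β γ) := by
  have h := PresentedGroup.one_of_mem (rels := wamsleyRelators α β γ
    (FreeGroup.of (0 : Fin 3)) (FreeGroup.of (1 : Fin 3)) (FreeGroup.of (2 : Fin 3)))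
    (x := FreeGroup.of 2 ^ γ * (comm (FreeGroup.of 0) (FreeGroup.of 1))⁻¹)
    (by simp [wamsleyRelators])
  have h' : Z α β γ ^ γ * (comm (X α β γ) (Y α β γ))⁻¹ = 1 := by
    simpa only [comm, map_mul, map_inv, map_pow, X, Y, Z, PresentedGroup.of] using h
  exact mul_inv_eq_one.mp h'

theorem lconj_pow {H : Type*} [Group H] {z y : H} {s : ℤ} (h : lconj z y = y ^ s) (m : ℕ) :
    lconj (z ^ m) y = y ^ (s ^ m) := by
  induction m with
  | zero => simp [lconj]
  | succ m ih =>
    have h1 : lconj (z ^ (m + 1)) y = z * lconj (z ^ m) y * z⁻¹ := by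
      simp only [lconj, pow_succ']; group
    rw [h1, ih, ← conj_zpow]
    change lconj z y ^ _ = _
    rw [h, ← zpow_mul, ← pow_succ']

theorem rconj_pow {H : Type*} [Group H] {z y : H} {s : ℤ} (h : rconj y z = y ^ s) (m : ℕ) :
    rconj y (z ^ m) = y ^ (s ^ m) := by
  have h1 : lconj z⁻¹ y = y ^ s := by simpa [lconj, rconj] using h
  simpa [lconj, rconj] using lconj_pow h1 m

/-- The homomorphism `Ω : G → W` with `A ↦ X`, `B ↦ Y`. -/
def Omega : G α β γ →* W α β γ :=
  PresentedGroup.toGroup (f := ![X α β γ, Y α β γ]) (by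
    intro r hr
    have hx := rconj_pow (X_rel α β γ) γ
    have hy := lconj_pow (Y_rel α β γ) γ
    rw [Z_rel] at hx hy
    rcases hr with rfl | rfl
    · simpa [rconj, comm, mul_inv_eq_one] using hx
    · simpa [lconj, comm, mul_inv_eq_one] using hy)

/-- `N` is the kernel of `Ω`. -/
abbrev N : Subgroup (G α β γ) := (Omega α β γ).ker

variable {α β γ}

/-- `N_p = N ∩ G_p`, as a subgroup of the Sylow `p`-subgroup `G_p = P` of `G`. -/
abbrev Np {p : ℕ} (P : Sylow p (G α β γ)) : Subgroup P := (N α β γ).subgroupOf P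

end Generators

end Wamsley

namespace Wamsley

/-! ### Conjugation and commutators -/

section Conj

variable {H K : Type*} [Group H] [Group K]

/-! The argument rests on three things: Macdonald's theorem, a construction that bounds `N` from
above, and the subgroup `Ω(G)` of `W`.

Macdonald's theorem (`MacdonaldRel.finite_and_isNilpotent`): a group generated by `a, b` with `a^c =
a^r`, `ᶜb = b^s`, `c = [a,b]`, `r, s ≠ 1`, is finite and nilpotent. Expanding `[a^(r^j), b] = [a,
b^(s^j)]^(c^j)` in two ways writes a power of `a` as `c^i b^y c^l`. Such a power is nearly central
(`zpow_eq_one_of_eq`), which makes `a` of finite order and forces every prime divisor of that order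
to divide `r - 1`. The resulting divisibilities of geometric sums produce central elements, and
induction on the product of the orders of `a, b, c` finishes.

Consequently the projection of `G` onto `P = G_p` is a power map `g ↦ g^e`. The group presented by
the Sylow relators again satisfies Macdonald's relations and is generated by `p`-elements, so it is
a `p`-group; as `e ≡ 1` modulo `p`, it is no larger than `P` (`isPresentedBy_sylow`).

For `N_p`, conjugation by `Z` in `W` acts as `a ↦ a^α`, `b ↦ b^μ` on the images and fixes their
commutator, so the stated elements lie in `N_p`. Conversely, in the quotient of `P` by them these
formulas define an automorphism whose `γ`-th power is conjugation by `[a,b]`; the corresponding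
cyclic extension receives a map from `W`, so nothing more dies (`Np_le_normalClosure_of_orderOf`).
This needs `μ` inverse to `β` modulo the order of `b`; nilpotency of `P` relaxes it to the order of
`b₀` (`Np_eq_normalClosure`).

Finally `Ω(P) ≅ P/N_p` is a normal `p`-subgroup of `W`, and `D = Z^(qk)` is a `p`-element whose
powers meet `Ω(P)` only in exponents divisible by `p^n`. Counting shows that `Ω(P)` and `D` generate
a Sylow subgroup (`exists_sylow_extension`), and `isPresentedBy_extension` gives its presentation.
-/

theorem rconj_zpow_left (x y : H) (t : ℤ) : rconj (x ^ t) y = rconj x y ^ t := by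
  have h := map_zpow (MulAut.conj y⁻¹) x t
  simpa [rconj, MulAut.conj_apply] using h

theorem lconj_eq_rconj_inv (x y : H) : lconj y x = rconj x y⁻¹ := by
  simp [lconj, rconj]

theorem comm_swap (x y : H) : comm y x = (comm x y)⁻¹ := by
  simp only [comm]; group

theorem map_rconj (f : H →* K) (x y : H) : f (rconj x y) = rconj (f x) (f y) := by
  simp [rconj]

theorem map_lconj (f : H →* K) (x y : H) : f (lconj x y) = lconj (f x) (f y) := by
  simp [lconj]

theorem map_comm (f : H →* K) (x y : H) : f (comm x y) = comm (f x) (f y) := by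
  simp [comm]

theorem rconj_comm (x y z : H) : rconj (comm x y) z = comm (rconj x z) (rconj y z) := by
  simp only [rconj, comm]; group

theorem rconj_eq_iff (x y w : H) : rconj x y = w ↔ x * y = y * w := by
  simp only [rconj, mul_assoc, inv_mul_eq_iff_eq_mul]

/-- Elements commuting with generators are central. -/
theorem commute_of_closure_eq_top {S : Set H} (hS : Subgroup.closure S = ⊤) {z : H}
    (h : ∀ x ∈ S, Commute z x) (g : H) : Commute z g := by
  have hle : Subgroup.closure S ≤ Subgroup.centralizer {z} := by
    rw [Subgroup.closure_le]
    intro x hx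
    rw [SetLike.mem_coe, Subgroup.mem_centralizer_singleton_iff]
    exact (h x hx).eq.symm
  have hg : g ∈ Subgroup.centralizer {z} := hle (hS ▸ Subgroup.mem_top g)
  exact (Subgroup.mem_centralizer_singleton_iff.mp hg).symm

end Conj

/-! ### The Macdonald relations -/

/-- `a` and `b` satisfy the relations of the Macdonald group with parameters `r` and `s`. -/
structure MacdonaldRel {H : Type*} [Group H] (r s : ℤ) (a b : H) : Prop where
  left : rconj a (comm a b) = a ^ r
  right : lconj (comm a b) b = b ^ s

/-- The exponent in `[a ^ m, b] = [a, b] ^ m * a ^ geomDefect r m`. -/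
def geomDefect (r : ℤ) (m : ℕ) : ℤ := ∑ i ∈ Finset.range m, r ^ (i + 1) - m * r ^ m

theorem sub_one_mul_geomDefect (r : ℤ) (m : ℕ) :
    (r - 1) * geomDefect r m = r * (r ^ m - 1) - m * r ^ m * (r - 1) := by
  have h := mul_geom_sum r m
  have h2 : ∑ i ∈ Finset.range m, r ^ (i + 1) = r * ∑ i ∈ Finset.range m, r ^ i := by
    rw [Finset.mul_sum]; exact Finset.sum_congr rfl fun i _ => pow_succ' r i
  rw [geomDefect, h2]
  linear_combination r * h

namespace MacdonaldRel

variable {H K : Type*} [Group H] [Group K] {r s : ℤ} {a b : H}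

theorem symm (h : MacdonaldRel r s a b) : MacdonaldRel s r b a where
  left := by rw [comm_swap, ← lconj_eq_rconj_inv]; exact h.right
  right := by rw [comm_swap, lconj_eq_rconj_inv, inv_inv]; exact h.left

theorem map (h : MacdonaldRel r s a b) (f : H →* K) : MacdonaldRel r s (f a) (f b) where
  left := by rw [← map_comm, ← map_rconj, h.left, map_zpow]
  right := by rw [← map_comm, ← map_lconj, h.right, map_zpow]

theorem rconj_left (h : MacdonaldRel r s a b) (k : ℕ) (t : ℤ) :
    rconj (a ^ t) (comm a b ^ k) = a ^ (t * r ^ k) := by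
  rw [rconj_zpow_left, rconj_pow h.left, ← zpow_mul, mul_comm]

theorem zpow_mul_comm_pow (h : MacdonaldRel r s a b) (k : ℕ) (t : ℤ) :
    a ^ t * comm a b ^ k = comm a b ^ k * a ^ (t * r ^ k) :=
  (rconj_eq_iff _ _ _).mp (h.rconj_left k t)

theorem mul_comm_pow (h : MacdonaldRel r s a b) (m : ℕ) :
    (a * comm a b) ^ m = comm a b ^ m * a ^ (∑ i ∈ Finset.range m, r ^ (i + 1)) := by
  induction m with
  | zero => simp
  | succ m ih =>
    rw [pow_succ', ih, Finset.sum_range_succ, zpow_add, ← mul_assoc, mul_assoc a, ← pow_succ']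
    have h1 := h.zpow_mul_comm_pow (m + 1) 1
    rw [zpow_one, one_mul] at h1
    rw [h1, mul_assoc, ← zpow_add, ← zpow_add, add_comm (r ^ (m + 1))]

/-- Since `b⁻¹ a b = a c` with `c = [a,b]`, the left side is `a⁻ᵐ (a c)ᵐ`; every `c` is then moved
to the front, each passage raising the powers of `a` to the `r`. -/
theorem comm_pow_left (h : MacdonaldRel r s a b) (m : ℕ) :
    comm (a ^ m) b = comm a b ^ m * a ^ geomDefect r m := by
  have h1 : comm (a ^ m) b = (a ^ m)⁻¹ * (a * comm a b) ^ m := by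
    have : a * comm a b = b⁻¹ * a * b := by simp only [comm]; group
    rw [this, show b⁻¹ * a * b = b⁻¹ * a * b⁻¹⁻¹ by simp, conj_pow]
    simp only [comm]; group
  have h2 := h.zpow_mul_comm_pow m (-m)
  rw [zpow_neg, zpow_natCast] at h2
  rw [h1, h.mul_comm_pow, ← mul_assoc, h2, mul_assoc, ← zpow_add, geomDefect]
  congr 2; ring

theorem comm_pow_right (h : MacdonaldRel r s a b) (n : ℕ) :
    comm a (b ^ n) = b ^ (-geomDefect s n) * comm a b ^ n := by
  rw [comm_swap, h.symm.comm_pow_left, comm_swap a b, mul_inv_rev, inv_pow, inv_inv, zpow_neg]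

/-- Only the shape of the right side matters. It serves the case `r = -1`, `s ≤ 0` of
`orderOf_ne_zero`. -/
theorem comm_zpow_neg_right (h : MacdonaldRel r s a b) (n : ℕ) :
    ∃ y : ℤ, comm a (b ^ (-(n : ℤ))) = (comm a b ^ n)⁻¹ * b ^ y := by
  have h1 := h.comm_pow_right n
  refine ⟨∑ i ∈ Finset.range n, s ^ (i + 1) - n, ?_⟩
  have h2 : comm a (b ^ (-(n : ℤ))) = (b ^ n * comm a (b ^ n) * (b ^ n)⁻¹)⁻¹ := by
    simp only [comm, zpow_neg, zpow_natCast]; group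
  have h3 : b ^ n * comm a (b ^ n) = b ^ (n : ℤ) * b ^ (-geomDefect s n) * comm a b ^ n := by
    rw [h1, zpow_natCast, mul_assoc]
  have h4 := h.symm.zpow_mul_comm_pow n (-(n : ℤ))
  rw [comm_swap a b, inv_pow, mul_inv_eq_iff_eq_mul, mul_assoc, eq_inv_mul_iff_mul_eq] at h4
  rw [h2, h3, mul_assoc, ← zpow_natCast b n, ← zpow_neg, h4, ← mul_assoc, ← zpow_add, ← zpow_add,
    mul_inv_rev, ← zpow_neg, geomDefect]
  congr 2; ring

/-- Conjugation by powers of `[a, b]` moves powers from `a` to `b`. -/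
theorem comm_zpow_pow (h : MacdonaldRel r s a b) (j : ℕ) :
    comm (a ^ (r ^ j)) b = rconj (comm a (b ^ (s ^ j))) (comm a b ^ j) := by
  have h1 := h.rconj_left j 1
  have h2 : rconj (b ^ (s ^ j)) (comm a b ^ j) = b := by
    rw [← lconj_pow h.right j]; simp only [rconj, lconj]; group
  rw [rconj_comm, h2]
  rw [zpow_one, one_mul] at h1
  rw [h1]

/-- Conjugating the hypothesis by `c` and dividing shows that `z = a^(x(r-1))` is conjugate under
`c^i` to a power of `b' = b^c`. So `z` commutes with a `c`-conjugate of `b` as well as with `a`, and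
a suitable `c`-conjugate of `z` is central. As conjugation by `c` raises powers of `a` to the `r`, a
central one is killed by `r - 1`. -/
theorem zpow_eq_one_of_eq (h : MacdonaldRel r s a b) (htop : Subgroup.closure {a, b} = ⊤)
    {x y i l : ℤ} (hx : a ^ x = comm a b ^ i * b ^ y * comm a b ^ l) :
    ∃ e : ℕ, a ^ (x * (r - 1) ^ 2 * r ^ e) = 1 := by
  set c := comm a b with hc
  set z := a ^ (x * (r - 1)) with hz
  set b' := c⁻¹ * b * c with hb'
  have hbs : b = b' ^ s := by
    have := h.right
    rw [← hc] at this
    have h2 : rconj (b ^ s) c = b := by rw [← this]; simp only [rconj, lconj]; group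
    rw [rconj_zpow_left] at h2
    exact h2.symm
  have h1 : a ^ (x * r) = c ^ i * b' ^ y * c ^ l := by
    have e1 := h.rconj_left 1 x
    rw [pow_one, pow_one, ← hc, hx] at e1
    have e2 : rconj (c ^ i * b ^ y * c ^ l) c = c ^ i * rconj (b ^ y) c * c ^ l := by
      simp only [rconj]; group
    rw [e2, rconj_zpow_left] at e1
    exact e1.symm
  have hz1 : z = c ^ i * b' ^ (y * (1 - s)) * c ^ (-i) := by
    have : z = a ^ (x * r) * (a ^ x)⁻¹ := by
      rw [hz, ← zpow_neg, ← zpow_add]; congr 1; ring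
    rw [this, h1, hx]
    have : b ^ y = b' ^ (s * y) := by rw [zpow_mul, ← hbs]
    rw [this, mul_sub, mul_one, zpow_sub, mul_comm y s]
    group
  have hzb : Commute z (c ^ (i - 1) * b * (c ^ (i - 1))⁻¹) := by
    have e1 : c ^ (i - 1) * b * (c ^ (i - 1))⁻¹ = c ^ i * b' * (c ^ i)⁻¹ := by
      rw [hb']; group
    have e2 : z = c ^ i * b' ^ (y * (1 - s)) * (c ^ i)⁻¹ := by rw [hz1, zpow_neg]
    rw [e1, e2]
    have : Commute (b' ^ (y * (1 - s))) b' := (Commute.refl b').zpow_left _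
    exact this.map (MulAut.conj (c ^ i))
  have hza (t : ℤ) (k : ℤ) : Commute (z ^ k) (a ^ t) := by
    rw [hz, ← zpow_mul]; exact Commute.zpow_zpow (Commute.refl a) _ _
  have hcen (w : H) (hwa : Commute w a) (hwb : Commute w b) (g : H) : Commute w g :=
    commute_of_closure_eq_top htop (by rintro x (rfl | rfl) <;> assumption) g
  have hfin (k : ℤ) (hk : Commute (z ^ k) c) : a ^ (x * (r - 1) ^ 2 * k) = 1 := by
    have e1 := h.rconj_left 1 (x * (r - 1) * k)
    rw [zpow_mul, ← hz, pow_one, pow_one, ← hc] at e1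
    have e2 : rconj (z ^ k) c = z ^ k := by
      rw [rconj_eq_iff]; exact hk.eq
    rw [e2, hz, ← zpow_mul] at e1
    have e3 : x * (r - 1) ^ 2 * k = x * (r - 1) * k * r - x * (r - 1) * k := by ring
    rw [e3, zpow_sub, ← e1, mul_inv_cancel]
  -- For `i - 1 = e ≥ 0` the central conjugate is `z^(c^e) = z^(r^e)`, which accounts for `r^e` in
  -- the conclusion. For `i - 1 = -e ≤ 0` it is `c^e z c^(-e)`; then `z` itself is central and no
  -- factor is lost.
  rcases le_total 0 (i - 1) with hi | hi
  · obtain ⟨e, he⟩ := Int.eq_ofNat_of_zero_le hi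
    refine ⟨e, hfin _ (hcen _ (by simpa using hza 1 (r ^ e)) ?_ c)⟩
    have e1 : z ^ (r ^ e) = rconj z (c ^ e) := by
      rw [hz, h.rconj_left e, ← zpow_mul]
    rw [e1]
    rw [he, zpow_natCast] at hzb
    have := hzb.map (MulAut.conj (c ^ e)⁻¹)
    simp only [MulAut.conj_apply, inv_inv] at this
    simp only [rconj]
    convert this using 1
    group
  · obtain ⟨e, he⟩ := Int.eq_ofNat_of_zero_le (neg_nonneg.mpr hi)
    refine ⟨0, hfin _ ?_⟩
    have hie : c ^ (i - 1) = (c ^ e)⁻¹ := by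
      rw [← zpow_natCast, ← he, ← zpow_neg, neg_neg]
    have e1 : Commute (c ^ e * z * (c ^ e)⁻¹) b := by
      rw [hie] at hzb
      have := hzb.map (MulAut.conj (c ^ e))
      simp only [MulAut.conj_apply] at this
      convert this using 1
      group
    have e2 : Commute (c ^ e * z * (c ^ e)⁻¹) a := by
      have h3 := h.rconj_left e 1
      rw [zpow_one, ← hc] at h3
      have h4 : a = c ^ e * a ^ (1 * r ^ e) * (c ^ e)⁻¹ := by
        rw [← h3]; simp only [rconj]; group
      have h5 := (hza (1 * r ^ e) 1).map (MulAut.conj (c ^ e))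
      rw [zpow_one] at h5
      simp only [MulAut.conj_apply] at h5
      rwa [← h4] at h5
    have e3 := hcen _ e2 e1 c
    rw [pow_zero, zpow_one]
    have := e3.map (MulAut.conj (c ^ e)⁻¹)
    simp only [MulAut.conj_apply, inv_inv] at this
    convert this using 1 <;> group

end MacdonaldRel

/-! ### Divisibility of geometric sums -/

/-- If it vanished, `sub_one_mul_geomDefect` would give `r^m ∣ r`. -/
theorem geomDefect_ne_zero {r : ℤ} (hr : 2 ≤ |r|) {m : ℕ} (hm : 2 ≤ m) : geomDefect r m ≠ 0 := by
  intro h0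
  have h1 := sub_one_mul_geomDefect r m
  rw [h0, mul_zero] at h1
  have h2 : r ^ m * (m * (r - 1) - r) = -r := by linear_combination h1
  have hr0 : r ≠ 0 := by rintro rfl; simp at hr
  have h3 : r ^ m ∣ r := ⟨-(m * (r - 1) - r), by linear_combination h1⟩
  have h4 : r ^ 2 ∣ r ^ 1 := by simpa using (pow_dvd_pow r hm).trans h3
  have h5 := Int.natAbs_dvd_natAbs.mpr h4
  rw [Int.natAbs_pow, Int.natAbs_pow] at h5
  have h6 : 2 ≤ r.natAbs := by rw [Int.abs_eq_natAbs] at hr; exact_mod_cast hr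
  have := (Nat.pow_dvd_pow_iff_le_right h6).mp h5
  omega

theorem geom_sum_mul_range (r : ℤ) (x y : ℕ) : ∑ i ∈ Finset.range (x * y), r ^ i =
    (∑ i ∈ Finset.range x, r ^ i) * ∑ i ∈ Finset.range y, (r ^ x) ^ i := by
  induction y with
  | zero => simp
  | succ y ih =>
    rw [Nat.mul_succ, Finset.sum_range_add, ih, Finset.sum_range_succ, mul_add]
    congr 1
    rw [Finset.sum_mul]
    exact Finset.sum_congr rfl fun i _ => by rw [pow_add, pow_mul, mul_comm]

/-- If all primes dividing `m` divide `r - 1`, then `m` divides `1 + r + ⋯ + r ^ (m - 1)`. -/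
theorem dvd_geom_sum {m : ℕ} (hm : m ≠ 0) :
    ∀ {r : ℤ}, (∀ p : ℕ, p.Prime → p ∣ m → (p : ℤ) ∣ r - 1) →
      (m : ℤ) ∣ ∑ i ∈ Finset.range m, r ^ i := by
  induction m using Nat.recOnMul with
  | zero => exact absurd rfl hm
  | one => simp
  | prime p hp =>
    intro r h
    have h1 := h p hp dvd_rfl
    have h2 : (∑ i ∈ Finset.range p, r ^ i) ≡ ∑ i ∈ Finset.range p, 1 [ZMOD p] := by
      refine Int.ModEq.sum fun i _ => ?_
      simpa using ((Int.modEq_iff_dvd.mpr h1).symm.pow i)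
    rw [Finset.sum_const, Finset.card_range, nsmul_one] at h2
    exact (Int.modEq_zero_iff_dvd.mp (h2.trans (by simp)))
  | mul x y hx hy =>
    intro r h
    have hx0 : x ≠ 0 := left_ne_zero_of_mul hm
    have hy0 : y ≠ 0 := right_ne_zero_of_mul hm
    have h1 := hx hx0 (r := r) fun p hp hd => h p hp (hd.mul_right y)
    have h2 := hy hy0 (r := r ^ x) fun p hp hd =>
      (h p hp (hd.mul_left x)).trans (by simpa using sub_dvd_pow_sub_pow r 1 x)
    rw [geom_sum_mul_range, Nat.cast_mul]
    exact mul_dvd_mul h1 h2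

/-- A sharpening of `dvd_geom_sum` at an odd prime dividing `r - 1`. -/
theorem mul_dvd_geom_sum_sub {p : ℕ} (hp : p.Prime) (hp2 : p ≠ 2) {m : ℕ} (hm : m ≠ 0) :
    ∀ {r : ℤ}, (p : ℤ) ∣ r - 1 → (∀ q : ℕ, q.Prime → q ∣ m → (q : ℤ) ∣ r - 1) →
      ((p * m : ℕ) : ℤ) ∣ ∑ i ∈ Finset.range m, r ^ i - m := by
  induction m using Nat.recOnMul with
  | zero => exact absurd rfl hm
  | one => simp
  | prime q hq =>
    intro r hpr h
    have h1 := h q hq dvd_rfl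
    by_cases hqp : q = p
    · subst hqp
      obtain ⟨t, ht⟩ := h1
      -- Modulo `q²` only the linear term in `r - 1 = qt` survives. Its coefficient in the sum is `0
      -- + 1 + ⋯ + (q-1)`, divisible by `q` because `q` is odd.
      have key (i : ℕ) : ((q * q : ℕ) : ℤ) ∣ r ^ i - (1 + i * (q * t)) := by
        have hr : r = q * t + 1 := by linarith
        induction i with
        | zero => simp
        | succ i ih =>
          obtain ⟨w, hw⟩ := ih
          refine ⟨w * r + i * t ^ 2, ?_⟩
          push_cast at hw ⊢
          rw [pow_succ]
          have : r ^ i = q * q * w + (1 + i * (q * t)) := by linarith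
          rw [this, hr]; ring
      have h2 : ((q * q : ℕ) : ℤ) ∣ ∑ i ∈ Finset.range q, (r ^ i - (1 + i * (q * t))) :=
        Finset.dvd_sum fun i _ => key i
      have h3 : ∑ i ∈ Finset.range q, ((i : ℤ) * (q * t)) =
          (∑ i ∈ Finset.range q, i : ℕ) * (q * t) := by
        rw [Nat.cast_sum, Finset.sum_mul]
      have h4 : q ∣ ∑ i ∈ Finset.range q, i := by
        have h5 := Finset.sum_range_id_mul_two q
        have h6 : q ∣ (∑ i ∈ Finset.range q, i) * 2 := h5 ▸ dvd_mul_right _ _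
        exact (Nat.Coprime.dvd_of_dvd_mul_right
          ((Nat.coprime_primes hq Nat.prime_two).mpr hp2) h6)
      obtain ⟨w, hw⟩ := h4
      rw [Finset.sum_sub_distrib, Finset.sum_add_distrib, h3, hw] at h2
      simp only [Finset.sum_const, Finset.card_range, nsmul_one] at h2
      have h5 : ∑ i ∈ Finset.range q, r ^ i - (q : ℤ) =
          (∑ i ∈ Finset.range q, r ^ i - ((q : ℤ) + (q * w : ℕ) * (q * t))) +
            ((q * q : ℕ) : ℤ) * (w * t) := by push_cast; ring
      rw [h5]
      exact dvd_add h2 (dvd_mul_right _ _)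
    · have hco : IsCoprime (p : ℤ) (q : ℤ) :=
        Nat.isCoprime_iff_coprime.mpr ((Nat.coprime_primes hp hq).mpr (Ne.symm hqp))
      rw [Nat.cast_mul]
      refine hco.mul_dvd ?_ (dvd_sub (dvd_geom_sum hq.ne_zero h) dvd_rfl)
      have h2 : (∑ i ∈ Finset.range q, r ^ i) ≡ ∑ i ∈ Finset.range q, 1 [ZMOD p] := by
        refine Int.ModEq.sum fun i _ => ?_
        simpa using ((Int.modEq_iff_dvd.mpr hpr).symm.pow i)
      rw [Finset.sum_const, Finset.card_range, nsmul_one] at h2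
      exact h2.symm.dvd
  | mul x y hx hy =>
    intro r hpr h
    have hx0 : x ≠ 0 := left_ne_zero_of_mul hm
    have hy0 : y ≠ 0 := right_ne_zero_of_mul hm
    have hsub : r - 1 ∣ r ^ x - 1 := by simpa using sub_dvd_pow_sub_pow r 1 x
    obtain ⟨v, hv⟩ := hx hx0 (r := r) hpr fun q hq hd => h q hq (hd.mul_right y)
    obtain ⟨w, hw⟩ := hy hy0 (r := r ^ x) (hpr.trans hsub)
      fun q hq hd => (h q hq (hd.mul_left x)).trans hsub
    rw [geom_sum_mul_range]
    have e1 : ∑ i ∈ Finset.range x, r ^ i = (p * x : ℕ) * v + x := by linarith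
    have e2 : ∑ i ∈ Finset.range y, (r ^ x) ^ i = (p * y : ℕ) * w + y := by linarith
    rw [e1, e2]
    exact ⟨p * v * w + v + w, by push_cast; ring⟩

theorem geomDefect_eq (r : ℤ) (m : ℕ) :
    geomDefect r m = r * ∑ i ∈ Finset.range m, r ^ i - m * r ^ m := by
  rw [geomDefect, Finset.mul_sum]
  simp only [pow_succ']

theorem dvd_geomDefect {m : ℕ} (hm : m ≠ 0) {r : ℤ}
    (h : ∀ p : ℕ, p.Prime → p ∣ m → (p : ℤ) ∣ r - 1) : (m : ℤ) ∣ geomDefect r m := by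
  rw [geomDefect_eq]
  exact dvd_sub ((dvd_geom_sum hm h).mul_left r) (dvd_mul_right _ _)

theorem mul_dvd_pow_sub_one {m : ℕ} (hm : m ≠ 0) {r : ℤ}
    (h : ∀ p : ℕ, p.Prime → p ∣ m → (p : ℤ) ∣ r - 1) {p : ℕ} (hp : (p : ℤ) ∣ r - 1) :
    ((p * m : ℕ) : ℤ) ∣ r ^ m - 1 := by
  rw [← mul_geom_sum, Nat.cast_mul]
  exact mul_dvd_mul hp (dvd_geom_sum hm h)

theorem mul_dvd_geomDefect {p : ℕ} (hp : p.Prime) (hp2 : p ≠ 2) {m : ℕ} (hm : m ≠ 0) {r : ℤ}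
    (hpr : (p : ℤ) ∣ r - 1) (h : ∀ q : ℕ, q.Prime → q ∣ m → (q : ℤ) ∣ r - 1) :
    ((p * m : ℕ) : ℤ) ∣ geomDefect r m := by
  have h1 := mul_dvd_geom_sum_sub hp hp2 hm hpr h
  have h2 := mul_dvd_pow_sub_one hm h hpr
  have h3 : geomDefect r m = r * (∑ i ∈ Finset.range m, r ^ i - m) - m * (r ^ m - 1) +
      m * (r - 1) := by
    rw [geomDefect_eq]; ring
  rw [h3]
  refine dvd_add (dvd_sub (h1.mul_left r) (h2.mul_left _)) ?_
  rw [mul_comm p m, Nat.cast_mul]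
  exact mul_dvd_mul_left _ hpr

/-! ### Orders of the generators -/

namespace MacdonaldRel

variable {H : Type*} [Group H] {r s : ℤ} {a b : H}

/-- Both sides of `comm_zpow_pow` are expanded, with natural exponents `m, n` standing in for `r^j,
s^j`. The result has the shape required by `zpow_eq_one_of_eq`. -/
theorem eq_of_modEq (h : MacdonaldRel r s a b) (j : ℕ) {m n : ℕ}
    (hm : a ^ m = a ^ (r ^ j)) (hn : b ^ n = b ^ (s ^ j)) :
    a ^ geomDefect r m = comm a b ^ (-(m : ℤ) - j) * b ^ (-geomDefect s n) *
      comm a b ^ ((n : ℤ) + j) := by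
  have h1 := h.comm_zpow_pow j
  rw [← hm, ← hn, h.comm_pow_left, h.comm_pow_right, ← eq_inv_mul_iff_mul_eq] at h1
  rw [h1, rconj]
  group

/-- It suffices to exhibit a nonzero power of `a` of the form `c^i b^y c^l`; then
`zpow_eq_one_of_eq` kills a nonzero power of `a`, as `r ≠ 0, 1`. -/
theorem orderOf_ne_zero (h : MacdonaldRel r s a b) (htop : Subgroup.closure {a, b} = ⊤)
    (hr : r ≠ 1) : orderOf a ≠ 0 := by
  have hfin {x y i l : ℤ} (hx0 : x ≠ 0) (hr0 : r ≠ 0)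
      (hx : a ^ x = comm a b ^ i * b ^ y * comm a b ^ l) : orderOf a ≠ 0 := by
    obtain ⟨e, he⟩ := h.zpow_eq_one_of_eq htop hx
    intro h0
    have h1 := orderOf_dvd_iff_zpow_eq_one.mpr he
    rw [h0, Nat.cast_zero, zero_dvd_iff] at h1
    have : r - 1 ≠ 0 := sub_ne_zero.mpr hr
    simp_all
  by_cases hr0 : r = 0
  · have h1 := h.left
    rw [hr0, zpow_zero, rconj_eq_iff, mul_one, mul_eq_right] at h1
    simp [h1]
  -- The general choice `m = r²` would be `m = 1`, where the defect is zero. Instead `a² = [a⁻¹, b]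
  -- c`, and `[a⁻¹, b]` is a conjugate of `[a, b^s]`.
  by_cases hr1 : r = -1
  · subst hr1
    have h1 := h.comm_zpow_pow 1
    rw [pow_one, pow_one, pow_one] at h1
    have h2 : a ^ (2 : ℤ) = comm (a ^ (-1 : ℤ)) b * comm a b := by
      have h3 := h.left
      rw [rconj_eq_iff, zpow_neg_one, ← inv_mul_eq_iff_eq_mul] at h3
      have h4 : comm (a ^ (-1 : ℤ)) b = a * (comm a b)⁻¹ * a⁻¹ := by
        simp only [comm, zpow_neg_one]; group
      rw [h4]
      have h5 : a⁻¹ = (comm a b)⁻¹ * a * comm a b := by rw [← h3, mul_assoc]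
      have h6 : (comm a b)⁻¹ * a⁻¹ * comm a b = a := by
        have := congrArg (·⁻¹) h5
        simp only [inv_inv, mul_inv_rev] at this
        rw [← mul_assoc] at this
        exact this.symm
      rw [mul_assoc, mul_assoc, ← mul_assoc _ a⁻¹, h6, zpow_two]
    rw [h1] at h2
    rcases le_total 0 s with hs | hs
    · obtain ⟨n, rfl⟩ := Int.eq_ofNat_of_zero_le hs
      rw [zpow_natCast, h.comm_pow_right] at h2
      refine hfin (x := 2) (y := -geomDefect n n) (i := -1) (l := n + 2) (by norm_num) hr0 ?_
      rw [h2, rconj]; group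
    · obtain ⟨n, hn⟩ := Int.eq_ofNat_of_zero_le (neg_nonneg.mpr hs)
      obtain rfl : s = -(n : ℤ) := by omega
      obtain ⟨y, hy⟩ := h.comm_zpow_neg_right n
      rw [hy] at h2
      refine hfin (x := 2) (y := y) (i := -1 - n) (l := 2) (by norm_num) hr0 ?_
      rw [h2, rconj, zpow_two]; group
  · have hr2 : 2 ≤ r.natAbs := by omega
    -- With `j = 2` the exponents `r^j` and `s^j` are natural numbers whatever the signs of `r` and
    -- `s`.
    refine hfin (geomDefect_ne_zero (m := r.natAbs ^ 2)
      (by rw [Int.abs_eq_natAbs]; exact_mod_cast hr2) ?_) hr0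
      (h.eq_of_modEq 2 (m := r.natAbs ^ 2) (n := s.natAbs ^ 2) ?_ ?_)
    · nlinarith
    · rw [← zpow_natCast, Nat.cast_pow, Int.natAbs_sq]
    · rw [← zpow_natCast, Nat.cast_pow, Int.natAbs_sq]

/-- `a^r` is conjugate to `a`, so it has the same finite order and generates the same cyclic group.
-/
theorem isCoprime_orderOf (h : MacdonaldRel r s a b) (ha : orderOf a ≠ 0) :
    IsCoprime r (orderOf a : ℤ) := by
  have h1 : orderOf (a ^ r) = orderOf a := by
    rw [← h.left, rconj]
    have := orderOf_injective (MulAut.conj (comm a b)⁻¹).toMonoidHom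
      (MulAut.conj (comm a b)⁻¹).injective a
    simpa using this
  have h2 : ∃ k : ℤ, a = (a ^ r) ^ k := by
    have hle : Subgroup.zpowers (a ^ r) ≤ Subgroup.zpowers a :=
      Subgroup.zpowers_le.mpr ⟨r, rfl⟩
    have : Finite (Subgroup.zpowers a) := by
      rw [← Nat.card_zpowers] at ha
      exact Nat.finite_of_card_ne_zero ha
    have heq := Subgroup.eq_of_le_of_card_ge hle (by rw [Nat.card_zpowers, Nat.card_zpowers, h1])
    have : a ∈ Subgroup.zpowers (a ^ r) := heq ▸ Subgroup.mem_zpowers a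
    obtain ⟨k, hk⟩ := this
    exact ⟨k, hk.symm⟩
  obtain ⟨k, hk⟩ := h2
  rw [← zpow_mul] at hk
  have h3 : a ^ (r * k - 1) = 1 := by rw [zpow_sub, ← hk, zpow_one, mul_inv_cancel]
  obtain ⟨t, ht⟩ := orderOf_dvd_iff_zpow_eq_one.mpr h3
  exact ⟨k, -t, by linear_combination ht⟩

theorem orderOf_dvd_geomDefect_mul (h : MacdonaldRel r s a b)
    (htop : Subgroup.closure {a, b} = ⊤) (ha : orderOf a ≠ 0) (hb : orderOf b ≠ 0) (j : ℕ)
    {m : ℕ} (hm : (m : ℤ) ≡ r ^ j [ZMOD orderOf a]) :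
    (orderOf a : ℤ) ∣ geomDefect r m * (r - 1) ^ 2 := by
  have h1 : a ^ m = a ^ (r ^ j) := by rw [← zpow_natCast, zpow_eq_zpow_iff_modEq]; exact hm
  have h2 : b ^ ((s ^ j) % orderOf b).toNat = b ^ (s ^ j) := by
    rw [← zpow_natCast, Int.toNat_of_nonneg (Int.emod_nonneg _ (by exact_mod_cast hb)),
      zpow_mod_orderOf]
  obtain ⟨e, he⟩ := h.zpow_eq_one_of_eq htop (h.eq_of_modEq j h1 h2)
  exact (h.isCoprime_orderOf ha).symm.pow_right.dvd_of_dvd_mul_right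
    (orderOf_dvd_iff_zpow_eq_one.mpr he)

/-- With `o` the order of `a`, `[a^o, b] = 1` makes `c^o` a power of `a`. It commutes with `c`, so
`o` divides `(r - 1) * geomDefect r o`, hence `r (r^o - 1)`, and `r` is prime to `o`. -/
theorem orderOf_dvd_pow_sub_one (h : MacdonaldRel r s a b) (ha : orderOf a ≠ 0) :
    (orderOf a : ℤ) ∣ r ^ orderOf a - 1 := by
  have h1 := h.comm_pow_left (orderOf a)
  rw [pow_orderOf_eq_one] at h1
  have h2 : comm a b ^ orderOf a = a ^ (-geomDefect r (orderOf a)) := by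
    have : comm 1 b = 1 := by simp [comm]
    rw [this] at h1
    rw [zpow_neg]; exact eq_inv_of_mul_eq_one_left h1.symm
  have h3 := h.rconj_left 1 (-geomDefect r (orderOf a))
  rw [← h2, pow_one, pow_one] at h3
  have h4 : rconj (comm a b ^ orderOf a) (comm a b) = comm a b ^ orderOf a := by
    rw [rconj_eq_iff, ← pow_succ, ← pow_succ']
  rw [h4, h2] at h3
  have h5 := (zpow_eq_zpow_iff_modEq.mp h3).dvd
  have h6 : (orderOf a : ℤ) ∣ (r - 1) * geomDefect r (orderOf a) := by
    obtain ⟨t, ht⟩ := h5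
    exact ⟨-t, by linear_combination -ht⟩
  rw [sub_one_mul_geomDefect] at h6
  have h7 : (orderOf a : ℤ) ∣ r * (r ^ orderOf a - 1) := by
    obtain ⟨t, ht⟩ := h6
    exact ⟨t + r ^ orderOf a * (r - 1), by linear_combination ht⟩
  exact (h.isCoprime_orderOf ha).symm.dvd_of_dvd_mul_left h7

/-- Suppose `p ∤ r - 1` and let `d` be the order of `r` modulo `p`; it divides the order of `a`.
Taking `j = φ(d)` and `m ≡ r^j` gives `m ≡ 1` modulo `d`, so that `(r - 1) * geomDefect r m ≡ r (r -
1) (1 - r^φ(d))` modulo `p`. This must vanish, so `d ∣ φ(d)`, which forces `d = 1`. -/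
theorem prime_dvd_sub_one (h : MacdonaldRel r s a b) (htop : Subgroup.closure {a, b} = ⊤)
    (ha : orderOf a ≠ 0) (hb : orderOf b ≠ 0) {p : ℕ} (hp : p.Prime) (hpa : p ∣ orderOf a) :
    (p : ℤ) ∣ r - 1 := by
  have := Fact.mk hp
  by_contra hpr
  have hpo : (p : ℤ) ∣ orderOf a := by exact_mod_cast hpa
  have hro : (r : ZMod p) ^ orderOf a = 1 := by
    have := (ZMod.intCast_zmod_eq_zero_iff_dvd _ _).mpr
      (hpo.trans (h.orderOf_dvd_pow_sub_one ha))
    push_cast at this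
    exact sub_eq_zero.mp this
  set d := orderOf (r : ZMod p) with hd
  have hdo : d ∣ orderOf a := orderOf_dvd_of_pow_eq_one hro
  have hd0 : 0 < d := Nat.pos_of_dvd_of_pos hdo (Nat.pos_of_ne_zero ha)
  have hrd : r ^ d.totient ≡ 1 [ZMOD d] := by
    have hco : IsCoprime r (d : ℤ) :=
      (h.isCoprime_orderOf ha).of_isCoprime_of_dvd_right (by exact_mod_cast hdo)
    obtain ⟨x, hx⟩ := (ZMod.coe_int_isUnit_iff_isCoprime r d).mpr hco.symm
    have := congrArg Units.val (ZMod.pow_totient x)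
    rw [← ZMod.intCast_eq_intCast_iff]
    push_cast
    rw [← hx]; simpa only [Units.val_pow_eq_pow_val, Units.val_one] using this
  set m := ((r ^ d.totient) % orderOf a).toNat with hm
  have hm1 : (m : ℤ) ≡ r ^ d.totient [ZMOD orderOf a] := by
    rw [hm, Int.toNat_of_nonneg (Int.emod_nonneg _ (by exact_mod_cast ha))]
    exact Int.mod_modEq _ _
  have h1 := hpo.trans (h.orderOf_dvd_geomDefect_mul htop ha hb _ hm1)
  have hpp : Prime (p : ℤ) := Nat.prime_iff_prime_int.mp hp
  have h2 : (p : ℤ) ∣ (r - 1) * geomDefect r m :=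
    ((hpp.dvd_or_dvd h1).resolve_right fun h => hpr (hpp.dvd_of_dvd_pow h)).mul_left _
  rw [sub_one_mul_geomDefect, ← ZMod.intCast_zmod_eq_zero_iff_dvd] at h2
  have h3 : (r : ZMod p) ^ m = r := by
    have : m ≡ 1 [MOD d] := by
      rw [← Int.natCast_modEq_iff]
      exact (hm1.of_dvd (by exact_mod_cast hdo)).trans (by simpa using hrd)
    simpa using pow_eq_pow_of_modEq this (pow_orderOf_eq_one (r : ZMod p))
  have h4 : (m : ZMod p) = (r : ZMod p) ^ d.totient := by
    have := (ZMod.intCast_eq_intCast_iff _ _ _).mpr (hm1.of_dvd hpo)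
    push_cast at this; exact this
  push_cast at h2
  rw [h3, h4] at h2
  have hr0 : (r : ZMod p) ≠ 0 := by
    intro h0; rw [h0, zero_pow ha] at hro; exact zero_ne_one hro
  have hr1 : (r : ZMod p) - 1 ≠ 0 := by
    intro h0
    apply hpr
    rw [← ZMod.intCast_zmod_eq_zero_iff_dvd]; push_cast; exact h0
  have h5 : (r : ZMod p) * (r - 1) * (1 - (r : ZMod p) ^ d.totient) = 0 := by
    linear_combination h2
  have h6 : (r : ZMod p) ^ d.totient = 1 := by
    rcases mul_eq_zero.mp h5 with h | h
    · exact absurd h (mul_ne_zero hr0 hr1)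
    · exact (sub_eq_zero.mp h).symm
  have h7 : d ≤ d.totient := Nat.le_of_dvd (Nat.totient_pos.mpr hd0) (orderOf_dvd_of_pow_eq_one h6)
  have h8 : ¬ 1 < d := fun h => absurd (Nat.totient_lt d h) (not_lt.mpr h7)
  have h9 : d = 1 := by omega
  exact hr1 (sub_eq_zero.mpr (orderOf_eq_one_iff.mp h9))

end MacdonaldRel

/-! ### Finiteness and nilpotency from central elements -/

theorem comm_eq_one_iff {H : Type*} [Group H] (x y : H) : comm x y = 1 ↔ Commute x y := by
  rw [comm, mul_assoc, ← mul_inv_rev, inv_mul_eq_one]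
  exact ⟨fun h => h.symm, fun h => h.eq.symm⟩

theorem finite_and_isNilpotent_of_quotient {H : Type*} [Group H] (K : Subgroup H) [K.Normal]
    (hK : K ≤ Subgroup.center H) [Finite K] (h : Finite (H ⧸ K) ∧ Group.IsNilpotent (H ⧸ K)) :
    Finite H ∧ Group.IsNilpotent H := by
  obtain ⟨h1, h2⟩ := h
  refine ⟨Finite.of_subgroup_quotient K, ?_⟩
  exact Subgroup.isNilpotent_of_ker_le_center (QuotientGroup.mk' K) (by simpa using hK)

namespace MacdonaldRel

variable {H : Type*} [Group H] {r s : ℤ} {a b : H}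

theorem orderOf_comm_dvd (h : MacdonaldRel r s a b) (ha : orderOf a ≠ 0)
    (hr : ∀ p : ℕ, p.Prime → p ∣ orderOf a → (p : ℤ) ∣ r - 1) :
    orderOf (comm a b) ∣ orderOf a := by
  apply orderOf_dvd_of_pow_eq_one
  have h1 := h.comm_pow_left (orderOf a)
  rw [pow_orderOf_eq_one, (comm_eq_one_iff _ _).mpr (Commute.one_left b),
    orderOf_dvd_iff_zpow_eq_one.mp (dvd_geomDefect ha hr), mul_one] at h1
  exact h1.symm

/-- Here `c^m = 1`, so `[a^m, b]` is `a` to the power `geomDefect r m`. For odd `p` this exponent is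
a multiple of `pm`; for `p = 2` only divisibility by `m` is available, leaving the values `1` and
`a^m`. -/
theorem commute_pow_left (h : MacdonaldRel r s a b) (htop : Subgroup.closure {a, b} = ⊤)
    (ha : orderOf a ≠ 0) (hr : ∀ p : ℕ, p.Prime → p ∣ orderOf a → (p : ℤ) ∣ r - 1)
    {p m : ℕ} (hp : p.Prime) (hpm : orderOf a = p * m) (hc : orderOf (comm a b) ∣ m) (g : H) :
    Commute (a ^ m) g := by
  refine commute_of_closure_eq_top htop ?_ g
  have hm0 : m ≠ 0 := by rintro rfl; exact ha (by simpa using hpm)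
  have hrm : ∀ q : ℕ, q.Prime → q ∣ m → (q : ℤ) ∣ r - 1 := fun q hq hd =>
    hr q hq (hpm ▸ hd.mul_left p)
  rintro x (rfl | rfl)
  · exact (Commute.refl x).pow_left m
  · have h1 := h.comm_pow_left m
    rw [orderOf_dvd_iff_pow_eq_one.mp hc, one_mul] at h1
    by_cases hp2 : p = 2
    · subst hp2
      obtain ⟨t, ht⟩ := dvd_geomDefect hm0 hrm
      have ha2 : a ^ (2 * m) = 1 := hpm ▸ pow_orderOf_eq_one a
      rcases Int.even_or_odd' t with ⟨w, rfl | rfl⟩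
      · rw [← comm_eq_one_iff, h1, ht,
          show (m : ℤ) * (2 * w) = ((2 * m : ℕ) : ℤ) * w by push_cast; ring, zpow_mul,
          zpow_natCast, ha2, one_zpow]
      -- In this case conjugation by `b` sends `a^m` to `a^(2m) = 1`, so `a^m` is trivial after all.
      · have h2 : comm (a ^ m) x = a ^ m := by
          rw [h1, ht, show (m : ℤ) * (2 * w + 1) = ((2 * m : ℕ) : ℤ) * w + m by push_cast; ring,
            zpow_add, zpow_mul, zpow_natCast, ha2, one_zpow, one_mul, zpow_natCast]
        have h3 : a ^ m = 1 := by
          have h4 : x⁻¹ * a ^ m * x = a ^ m * comm (a ^ m) x := by simp only [comm]; group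
          rw [h2, ← pow_add, ← two_mul, ha2] at h4
          have h5 : a ^ m = x * (x⁻¹ * a ^ m * x) * x⁻¹ := by group
          rw [h5, h4]; group
        rw [h3]; exact Commute.one_left x
    · rw [← comm_eq_one_iff, h1, ← orderOf_dvd_iff_zpow_eq_one, hpm]
      exact mul_dvd_geomDefect hp hp2 hm0 (hr p hp (hpm ▸ dvd_mul_right p m)) hrm

theorem commute_comm_pow (h : MacdonaldRel r s a b) (ha : orderOf a ≠ 0)
    (hr : ∀ p : ℕ, p.Prime → p ∣ orderOf a → (p : ℤ) ∣ r - 1)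
    {p m : ℕ} (hp : p.Prime) (hpm : orderOf a = p * m) : Commute (comm a b ^ m) a := by
  have hm0 : m ≠ 0 := by rintro rfl; exact ha (by simpa using hpm)
  have h1 := mul_dvd_pow_sub_one hm0 (fun q hq hd => hr q hq (hpm ▸ hd.mul_left p))
    (hr p hp (hpm ▸ dvd_mul_right p m))
  rw [← hpm, orderOf_dvd_iff_zpow_eq_one, zpow_sub, zpow_one, mul_inv_eq_one] at h1
  have h2 := h.zpow_mul_comm_pow m 1
  rw [one_mul, zpow_one, h1] at h2
  exact h2.symm

/-- A nontrivial central element of finite order is factored out, lowering the product of the three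
orders. It is `a^m` or `b^m` when one generator has order `pm` with `c^m = 1`; otherwise `a, b, c`
have equal orders and a power of `c` is central. -/
theorem finite_and_isNilpotent_of_orderOf_mul_eq (N : ℕ) : ∀ (H : Type*) [Group H] (a b : H),
    MacdonaldRel r s a b → Subgroup.closure {a, b} = ⊤ → orderOf a ≠ 0 → orderOf b ≠ 0 →
    (∀ p : ℕ, p.Prime → p ∣ orderOf a → (p : ℤ) ∣ r - 1) →
    (∀ p : ℕ, p.Prime → p ∣ orderOf b → (p : ℤ) ∣ s - 1) →
    orderOf a * orderOf b * orderOf (comm a b) = N → Finite H ∧ Group.IsNilpotent H := by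
  induction N using Nat.strong_induction_on with
  | _ N ih =>
  intro H _ a b h htop ha hb hr hs hN
  have hca := h.orderOf_comm_dvd ha hr
  have hcb := h.symm.orderOf_comm_dvd hb hs
  have htop' : Subgroup.closure {b, a} = ⊤ := by rwa [Set.pair_comm]
  rw [comm_swap, orderOf_inv] at hcb
  have hc0 : orderOf (comm a b) ≠ 0 := fun h0 => ha (by rwa [h0, zero_dvd_iff] at hca)
  have step (z : H) (hz : ∀ g, Commute z g) (hz0 : orderOf z ≠ 0)
      (hlt : ∀ f : H →* H ⧸ Subgroup.normalClosure {z}, f z = 1 →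
        orderOf (f a) * orderOf (f b) * orderOf (f (comm a b)) < N) :
      Finite H ∧ Group.IsNilpotent H := by
    have hzc : Subgroup.zpowers z ≤ Subgroup.center H := by
      rw [Subgroup.zpowers_le, Subgroup.mem_center_iff]
      exact fun g => (hz g).eq.symm
    have hle : Subgroup.normalClosure {z} ≤ Subgroup.zpowers z := by
      have : (Subgroup.zpowers z).Normal := ⟨fun n hn g => by
        rwa [Subgroup.mem_center_iff.mp (hzc hn) g, mul_inv_cancel_right]⟩
      exact Subgroup.normalClosure_le_normal (by simp)
    have : Finite (Subgroup.zpowers z) := by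
      rw [← Nat.card_zpowers] at hz0; exact Nat.finite_of_card_ne_zero hz0
    have : Finite (Subgroup.normalClosure {z}) :=
      Finite.of_injective _ (Subgroup.inclusion_injective hle)
    refine finite_and_isNilpotent_of_quotient (Subgroup.normalClosure {z}) (hle.trans hzc) ?_
    set f := QuotientGroup.mk' (Subgroup.normalClosure {z})
    have hf : f z = 1 := (QuotientGroup.eq_one_iff z).mpr (Subgroup.subset_normalClosure rfl)
    have h1 := hlt f hf
    rw [map_comm] at h1
    have da := orderOf_map_dvd f a
    have db := orderOf_map_dvd f b
    refine ih _ h1 _ (f a) (f b) (h.map f) ?_ (fun h0 => ha (by rwa [h0, zero_dvd_iff] at da))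
      (fun h0 => hb (by rwa [h0, zero_dvd_iff] at db)) (fun p hp hd => hr p hp (hd.trans da))
      (fun p hp hd => hs p hp (hd.trans db)) rfl
    rw [← Set.image_pair, ← MonoidHom.map_closure, htop]
    exact Subgroup.map_top_of_surjective f (QuotientGroup.mk'_surjective _)
  have hlt_of_pow {x y : H} {p m : ℕ} (hp : p.Prime) (hx0 : orderOf x ≠ 0)
      (hpm : orderOf x = p * m) (f : H →* H ⧸ Subgroup.normalClosure {y}) (hf : f (x ^ m) = 1) :
      orderOf (f x) < orderOf x := by
    have hm0 : 0 < m := Nat.pos_of_ne_zero (by rintro rfl; exact hx0 (by simpa using hpm))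
    rw [map_pow] at hf
    have h1 := Nat.le_of_dvd hm0 (orderOf_dvd_of_pow_eq_one hf)
    rw [hpm]
    nlinarith [hp.two_le]
  have hle_of_map {x y : H} (hx0 : orderOf x ≠ 0) (f : H →* H ⧸ Subgroup.normalClosure {y}) :
      orderOf (f x) ≤ orderOf x :=
    Nat.le_of_dvd (Nat.pos_of_ne_zero hx0) (orderOf_map_dvd f x)
  have hpow0 {x : H} (hx0 : orderOf x ≠ 0) (m : ℕ) : orderOf (x ^ m) ≠ 0 := fun h0 =>
    hx0 (zero_dvd_iff.mp (h0 ▸ orderOf_pow_dvd (x := x) m))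
  by_cases hA : ∃ p m : ℕ, p.Prime ∧ orderOf a = p * m ∧ orderOf (comm a b) ∣ m
  · obtain ⟨p, m, hp, hpm, hcm⟩ := hA
    refine step (a ^ m) (h.commute_pow_left htop ha hr hp hpm hcm) (hpow0 ha m) fun f hf => ?_
    rw [← hN]
    exact Nat.mul_lt_mul_of_lt_of_le (Nat.mul_lt_mul_of_lt_of_le (hlt_of_pow hp ha hpm f hf)
      (hle_of_map hb f) (by omega)) (hle_of_map hc0 f) (by omega)
  by_cases hB : ∃ p m : ℕ, p.Prime ∧ orderOf b = p * m ∧ orderOf (comm a b) ∣ m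
  · obtain ⟨p, m, hp, hpm, hcm⟩ := hB
    refine step (b ^ m) (h.symm.commute_pow_left htop' hb hs hp hpm
      (by rwa [comm_swap, orderOf_inv])) (hpow0 hb m) fun f hf => ?_
    rw [← hN]
    exact Nat.mul_lt_mul_of_lt_of_le (Nat.mul_lt_mul_of_le_of_lt (hle_of_map ha f)
      (hlt_of_pow hp hb hpm f hf) (by omega)) (hle_of_map hc0 f) (by omega)
  -- A prime dividing the quotient of the two orders would give the excluded factorization.
  have heq {x : H} (hx0 : orderOf x ≠ 0) (hcx : orderOf (comm a b) ∣ orderOf x)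
      (hx : ¬ ∃ p m : ℕ, p.Prime ∧ orderOf x = p * m ∧ orderOf (comm a b) ∣ m) :
      orderOf x = orderOf (comm a b) := by
    obtain ⟨t, ht⟩ := hcx
    by_contra hne
    have ht1 : t ≠ 1 := by rintro rfl; exact hne (by simpa using ht)
    obtain ⟨p, hp, w, rfl⟩ := Nat.exists_prime_and_dvd ht1
    exact hx ⟨p, orderOf (comm a b) * w, hp, by rw [ht]; ring, dvd_mul_right _ _⟩
  have hac := heq ha hca hA
  have hbc := heq hb hcb hB
  by_cases hc1 : orderOf (comm a b) = 1
  · rw [hc1, orderOf_eq_one_iff] at hac hbc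
    have hsub : Subsingleton H := by
      rw [← Subgroup.subsingleton_iff, ← subsingleton_iff_bot_eq_top]
      rw [← htop, hac, hbc, Set.pair_eq_singleton, Subgroup.closure_singleton_one]
    exact ⟨inferInstance, inferInstance⟩
  · obtain ⟨p, hp, m, hpm⟩ := Nat.exists_prime_and_dvd hc1
    refine step (comm a b ^ m) (commute_of_closure_eq_top htop ?_) (hpow0 hc0 m) fun f hf => ?_
    · rintro x (rfl | rfl)
      · exact h.commute_comm_pow ha hr hp (hac.trans hpm)
      · have := h.symm.commute_comm_pow hb hs hp (hbc.trans hpm)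
        rw [comm_swap, inv_pow] at this
        simpa using this
    · rw [← hN]
      exact Nat.mul_lt_mul_of_le_of_lt (Nat.mul_le_mul (hle_of_map ha f) (hle_of_map hb f))
        (hlt_of_pow hp hc0 hpm f hf) (by positivity)

/-- Macdonald's theorem. -/
theorem finite_and_isNilpotent (h : MacdonaldRel r s a b) (htop : Subgroup.closure {a, b} = ⊤)
    (hr : r ≠ 1) (hs : s ≠ 1) : Finite H ∧ Group.IsNilpotent H := by
  have htop' : Subgroup.closure {b, a} = ⊤ := by rwa [Set.pair_comm]
  have ha := h.orderOf_ne_zero htop hr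
  have hb := h.symm.orderOf_ne_zero htop' hs
  exact finite_and_isNilpotent_of_orderOf_mul_eq _ H a b h htop ha hb
    (fun p hp hd => h.prime_dvd_sub_one htop ha hb hp hd)
    (fun p hp hd => h.symm.prime_dvd_sub_one htop' hb ha hp hd) rfl

end MacdonaldRel

/-! ### Finite nilpotent groups -/

section Nilpotent

variable {H : Type*} [Group H]

theorem IsPGroup.eq_one_of_pow_eq_one {p : ℕ} (h : IsPGroup p H) {e : ℕ} (he : e ≡ 1 [MOD p])
    {x : H} (hx : x ^ e = 1) : x = 1 := by
  obtain ⟨k, hk⟩ := h x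
  have hco : Nat.Coprime (p ^ k) e := by
    apply Nat.Coprime.pow_left
    rw [Nat.Coprime, Nat.gcd_comm, he.gcd_eq, Nat.gcd_one_left]
  have h1 := Nat.dvd_gcd (orderOf_dvd_of_pow_eq_one hk) (orderOf_dvd_of_pow_eq_one hx)
  rw [hco.gcd_eq_one] at h1
  exact orderOf_eq_one_iff.mp (Nat.dvd_one.mp h1)

theorem card_sylow_dvd_index [Finite H] {p q : ℕ} [Fact p.Prime] [Fact q.Prime] (hpq : p ≠ q)
    (P : Sylow p H) (Q : Sylow q H) : Nat.card Q ∣ (P : Subgroup H).index := by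
  have h1 : Nat.card Q ∣ Nat.card P * (P : Subgroup H).index := by
    rw [Subgroup.card_mul_index]; exact Subgroup.card_subgroup_dvd_card _
  exact (IsPGroup.coprime_card_of_ne q p hpq.symm _ _ Q.2 P.2).dvd_of_dvd_mul_left h1

/-- The group is the direct product of its Sylow subgroups; the `e`-th power is the identity on the
`p`-component and trivial on the others. -/
theorem mul_pow_of_isNilpotent [Finite H] [Group.IsNilpotent H] {p : ℕ} [Fact p.Prime]
    (P : Sylow p H) {e : ℕ} (h1 : e ≡ 1 [MOD Nat.card P]) (h0 : (P : Subgroup H).index ∣ e)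
    (g h : H) : (g * h) ^ e = g ^ e * h ^ e := by
  obtain ⟨φ⟩ := ((Group.isNilpotent_of_finite_tfae (G := H)).out 0 4).mp ‹_›
  apply φ.symm.injective
  simp only [map_pow, map_mul]
  funext q Q
  simp only [Pi.pow_apply, Pi.mul_apply]
  generalize φ.symm g q Q = x
  generalize φ.symm h q Q = y
  have hq := Fact.mk (Nat.prime_of_mem_primeFactors q.2)
  by_cases hqp : p = q
  · have hcard : Nat.card Q = Nat.card P := by
      rw [Sylow.card_eq_multiplicity, Sylow.card_eq_multiplicity, hqp]
    have (w : Q) : w ^ e = w := by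
      have := pow_eq_pow_of_modEq (hcard ▸ h1) (pow_card_eq_one' (x := w))
      rwa [pow_one] at this
    rw [this, this, this]
  · have (w : Q) : w ^ e = 1 := orderOf_dvd_iff_pow_eq_one.mp
      ((orderOf_dvd_natCard w).trans ((card_sylow_dvd_index hqp P Q).trans h0))
    rw [this, this, this, one_mul]

/-- The projection of a finite nilpotent group onto its Sylow `p`-subgroup is a power map. -/
theorem exists_sylow_projection [Finite H] [Group.IsNilpotent H] {p : ℕ} [hp : Fact p.Prime]
    (P : Sylow p H) : ∃ (e : ℕ) (π : H →* P), (∀ g, (π g : H) = g ^ e) ∧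
      e ≡ 1 [MOD p] ∧ e ≡ 1 [MOD Nat.card P] := by
  -- The extra factor `p` makes `e ≡ 1` modulo `p` even when `P` is trivial.
  have hco : Nat.Coprime (p * Nat.card P) (P : Subgroup H).index := by
    refine Nat.Coprime.mul_left ((Nat.Prime.coprime_iff_not_dvd hp.out).mpr P.not_dvd_index)
      P.card_coprime_index
  obtain ⟨e, he1, he0⟩ := Nat.chineseRemainder hco 1 0
  have h1 : e ≡ 1 [MOD Nat.card P] := he1.of_mul_left p
  have h0 : (P : Subgroup H).index ∣ e := (Nat.modEq_zero_iff_dvd).mp he0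
  have hmem (g : H) : g ^ e ∈ P := by
    obtain ⟨t, rfl⟩ := h0
    rw [pow_mul]
    exact Subgroup.pow_mem _ (Subgroup.pow_index_mem (P : Subgroup H) g) t
  exact ⟨e, MonoidHom.mk' (fun g => ⟨g ^ e, hmem g⟩)
    fun g h => Subtype.ext (mul_pow_of_isNilpotent P h1 h0 g h), fun g => rfl,
    he1.of_mul_right _, h1⟩

/-- Modulo `M` the image of `N` lies in its own commutator with the whole group, hence in every term
of the lower central series. -/
theorem le_of_le_sup_commutator_top [Group.IsNilpotent H] {M N : Subgroup H} [M.Normal]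
    (h : N ≤ M ⊔ ⁅N, ⊤⁆) : N ≤ M := by
  let f := QuotientGroup.mk' M
  have hf : Function.Surjective f := QuotientGroup.mk'_surjective M
  have h1 : N.map f ≤ ⁅N.map f, ⊤⁆ := by
    have h2 := Subgroup.map_mono (f := f) h
    rwa [Subgroup.map_sup, Subgroup.map_commutator, Subgroup.map_top_of_surjective f hf,
      (Subgroup.map_eq_bot_iff M).mpr (QuotientGroup.ker_mk' M).ge, bot_sup_eq] at h2
  have key (n : ℕ) : N.map f ≤ (⊤ : Subgroup (H ⧸ M)).lowerCentralSeries n := by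
    induction n with
    | zero => exact le_top
    | succ n ih => exact h1.trans (Subgroup.commutator_mono ih le_rfl)
  have hnil : Group.IsNilpotent (H ⧸ M) := inferInstance
  obtain ⟨n, hn⟩ := Subgroup.nilpotent_iff_lowerCentralSeries.mp hnil
  have h3 := key n
  rw [hn, le_bot_iff, Subgroup.map_eq_bot_iff, QuotientGroup.ker_mk'] at h3
  exact h3

end Nilpotent

/-! ### Presentations -/

section Presentation

variable {ι H K : Type*} [Group H] [Group K] {g : ι → H} {rels : Set (FreeGroup ι)}

theorem IsPresentedBy.exists_hom (h : IsPresentedBy g rels) (f : ι → K)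
    (hf : ∀ r ∈ rels, FreeGroup.lift f r = 1) : ∃ φ : H →* K, ∀ i, φ (g i) = f i := by
  have hle : (FreeGroup.lift g).ker ≤ (FreeGroup.lift f).ker := by
    rw [h.2]; exact Subgroup.normalClosure_le_normal hf
  refine ⟨(FreeGroup.lift g).liftOfSurjective h.1 ⟨FreeGroup.lift f, hle⟩, fun i => ?_⟩
  have := (FreeGroup.lift g).liftOfRightInverse_comp_apply _
    (Function.rightInverse_surjInv h.1) ⟨FreeGroup.lift f, hle⟩ (FreeGroup.of i)
  simpa using this

theorem IsPresentedBy.quotient (h : IsPresentedBy g rels) (S : Set (FreeGroup ι)) (M : Subgroup H)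
    [M.Normal] (hM : M = Subgroup.normalClosure (FreeGroup.lift g '' S)) :
    IsPresentedBy (fun i => (QuotientGroup.mk (g i) : H ⧸ M)) (rels ∪ S) := by
  have hlift : FreeGroup.lift (fun i => (QuotientGroup.mk (g i) : H ⧸ M)) =
      (QuotientGroup.mk' M).comp (FreeGroup.lift g) := by
    ext i; simp
  refine ⟨?_, ?_⟩
  · rw [hlift]; exact (QuotientGroup.mk'_surjective M).comp h.1
  · rw [hlift, ← MonoidHom.comap_ker, QuotientGroup.ker_mk', hM,
      ← Subgroup.map_normalClosure _ _ h.1, Subgroup.comap_map_eq, h.2]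
    refine le_antisymm (sup_le (Subgroup.normalClosure_mono Set.subset_union_right)
      (Subgroup.normalClosure_mono Set.subset_union_left)) ?_
    refine Subgroup.normalClosure_le_normal (Set.union_subset ?_ ?_)
    · exact Subgroup.subset_normalClosure.trans (SetLike.coe_subset_coe.mpr le_sup_right)
    · exact Subgroup.subset_normalClosure.trans (SetLike.coe_subset_coe.mpr le_sup_left)

theorem image_sylowRelators (f : H →* K) (α β : ℤ) (γ u v : ℕ) (a b : H) :
    f '' sylowRelators α β γ u v a b = sylowRelators α β γ u v (f a) (f b) := by
  simp [sylowRelators, Set.image_insert_eq, map_rconj, map_comm]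

theorem image_commElements (f : H →* K) (α μ : ℤ) (γ : ℕ) (a b : H) :
    f '' commElements α μ γ a b = commElements α μ γ (f a) (f b) := by
  ext x
  simp only [commElements, Set.mem_image, Set.mem_ofPred_eq]
  constructor
  · rintro ⟨_, ⟨i, h1, h2, rfl⟩, rfl⟩
    exact ⟨i, h1, h2, by simp [map_comm]⟩
  · rintro ⟨i, h1, h2, rfl⟩
    exact ⟨_, ⟨i, h1, h2, rfl⟩, by simp [map_comm]⟩

theorem image_extensionRelators (f : H →* K) (α μ : ℤ) (e m q : ℕ) (a b d : H) :
    f '' extensionRelators α μ e m q a b d = extensionRelators α μ e m q (f a) (f b) (f d) := by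
  simp [extensionRelators, Set.image_insert_eq, map_rconj, map_comm]

theorem sylowRelators_eq_one_iff {α β : ℤ} {γ u v : ℕ} {a b : H} :
    (∀ x ∈ sylowRelators α β γ u v a b, x = 1) ↔
      MacdonaldRel (α ^ γ) (β ^ γ) a b ∧ a ^ u = 1 ∧ b ^ v = 1 := by
  simp only [sylowRelators, Set.mem_insert_iff, Set.mem_singleton_iff, forall_eq_or_imp, forall_eq,
    mul_inv_eq_one]
  constructor
  · rintro ⟨h1, h2, h3, h4⟩
    exact ⟨⟨h1, by rw [lconj_eq_rconj_inv, ← comm_swap]; exact h2⟩, h3, h4⟩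
  · rintro ⟨h, h3, h4⟩
    exact ⟨h.left, h.symm.left, h3, h4⟩

theorem commElements_eq_one_iff {α μ : ℤ} {γ : ℕ} {a b : H} :
    (∀ x ∈ commElements α μ γ a b, x = 1) ↔
      ∀ i : ℕ, 1 ≤ i → i < γ → comm (a ^ (α ^ i)) (b ^ (μ ^ i)) = comm a b := by
  constructor
  · intro h i h1 h2
    exact mul_inv_eq_one.mp (h _ ⟨i, h1, h2, rfl⟩)
  · rintro h x ⟨i, h1, h2, rfl⟩
    exact mul_inv_eq_one.mpr (h i h1 h2)

theorem extensionRelators_eq_one_iff {α μ : ℤ} {e m q : ℕ} {a b d : H} :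
    (∀ x ∈ extensionRelators α μ e m q a b d, x = 1) ↔
      rconj a d = a ^ (α ^ e) ∧ rconj b d = b ^ (μ ^ e) ∧ d ^ m = comm a b ^ q := by
  simp only [extensionRelators, Set.mem_insert_iff, Set.mem_singleton_iff, forall_eq_or_imp,
    forall_eq, mul_inv_eq_one]

end Presentation

/-! ### Cyclic extensions -/

/-- If the automorphism `θ` fixes `c` and `θ ^ γ` is conjugation by `c`, then `E` embeds in a group
with an element `z` that induces `θ` on `E` and satisfies `z ^ γ = c`. -/
theorem exists_cyclic_extension.{w} {E : Type w} [Group E] (θ : MulAut E) (c : E)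
    {γ : ℕ} (hγ : 0 < γ) (hc : θ c = c) (hθ : ∀ x, (θ ^ γ) x = rconj x c) :
    ∃ (F : Type w) (_ : Group F) (j : E →* F) (z : F), Function.Injective j ∧
      (∀ x, j (θ x) = rconj (j x) z) ∧ z ^ γ = j c := by
  -- The inverse appears because `rconj` by `t` is the inverse of the action of `t` in the
  -- semidirect product.
  let φ : Multiplicative ℤ →* MulAut E := zpowersHom (MulAut E) θ⁻¹
  let S := E ⋊[φ] Multiplicative ℤ
  let inl : E →* S := SemidirectProduct.inl
  let t : S := SemidirectProduct.inr (Multiplicative.ofAdd 1)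
  have ht (x : E) : rconj (inl x) t = inl (θ x) := by
    have h1 := SemidirectProduct.inl_aut_inv (φ := φ) (Multiplicative.ofAdd 1) x
    have h2 : (φ (Multiplicative.ofAdd 1))⁻¹ = θ := by simp [φ]
    rw [h2, map_inv] at h1
    exact h1.symm
  have htn (x : E) (n : ℕ) : rconj (inl x) (t ^ n) = inl ((θ ^ n) x) := by
    induction n with
    | zero => simp [rconj]
    | succ n ih =>
      have : rconj (inl x) (t ^ (n + 1)) = rconj (rconj (inl x) (t ^ n)) t := by
        simp only [rconj, pow_succ]; group
      rw [this, ih, ht, pow_succ']; rfl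
  -- This element is central because `t^γ` and `c` induce the same automorphism of `E` and `t` fixes
  -- `c`. Its nontrivial powers lie outside `E`, as `γ > 0`, so `E` survives in the quotient.
  let ζ : S := t ^ γ * inl c⁻¹
  have hζx (x : E) : Commute ζ (inl x) := by
    have h1 := htn x γ
    rw [hθ, map_rconj, rconj_eq_iff] at h1
    show t ^ γ * inl c⁻¹ * inl x = inl x * (t ^ γ * inl c⁻¹)
    rw [← mul_assoc, h1, map_inv, rconj]
    group
  have hζt : Commute ζ t := by
    have h1 := ht c
    rw [hc, rconj_eq_iff] at h1
    have h2 : Commute (inl c) t := h1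
    rw [show ζ = t ^ γ * (inl c)⁻¹ by simp [ζ]]
    exact ((Commute.refl t).pow_left γ).mul_left h2.inv_left
  have hζ (w : S) : Commute ζ w := by
    have hw : w = inl w.left * t ^ (Multiplicative.toAdd w.right) := by
      have h1 := SemidirectProduct.inl_left_mul_inr_right w
      have h2 : t ^ (Multiplicative.toAdd w.right) = SemidirectProduct.inr w.right := by
        rw [← map_zpow, ← Int.ofAdd_mul, one_mul, ofAdd_toAdd]
      rw [h2]; exact h1.symm
    rw [hw]
    exact (hζx _).mul_right (hζt.zpow_right _)
  have hnorm : (Subgroup.zpowers ζ).Normal := ⟨by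
    rintro _ ⟨k, rfl⟩ w
    have := (hζ w).zpow_left k
    exact ⟨k, by simp only []; rw [← this.eq, mul_inv_cancel_right]⟩⟩
  refine ⟨S ⧸ Subgroup.zpowers ζ, inferInstance, (QuotientGroup.mk' _).comp inl,
    QuotientGroup.mk' _ t, ?_, ?_, ?_⟩
  · rw [injective_iff_map_eq_one]
    intro x hx
    obtain ⟨k, hk⟩ := (QuotientGroup.eq_one_iff _).mp hx
    have h1 := congrArg SemidirectProduct.rightHom hk
    have h2 : SemidirectProduct.rightHom ζ = Multiplicative.ofAdd (γ : ℤ) := by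
      have e1 : SemidirectProduct.rightHom t = Multiplicative.ofAdd (1 : ℤ) :=
        SemidirectProduct.rightHom_inr _
      have e2 : SemidirectProduct.rightHom (inl c⁻¹) = 1 := SemidirectProduct.rightHom_inl _
      rw [map_mul, map_pow, e1, e2, mul_one, ← ofAdd_nsmul, nsmul_one]
    simp only [map_zpow, h2] at h1
    have h3 : SemidirectProduct.rightHom (inl x) = 1 := SemidirectProduct.rightHom_inl _
    rw [h3, ← Int.ofAdd_mul, ofAdd_eq_one] at h1
    have hk0 : k = 0 := by
      rcases mul_eq_zero.mp h1 with h | h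
      · exact absurd h (by exact_mod_cast hγ.ne')
      · exact h
    rw [hk0] at hk
    simp only [zpow_zero] at hk
    exact SemidirectProduct.inl_injective (φ := φ) (hk.symm.trans (map_one inl).symm)
  · intro x
    rw [MonoidHom.comp_apply, MonoidHom.comp_apply, ← ht, map_rconj]
  · rw [← map_pow, MonoidHom.comp_apply]
    have : (QuotientGroup.mk' (Subgroup.zpowers ζ)) ζ = 1 :=
      (QuotientGroup.eq_one_iff _).mpr (Subgroup.mem_zpowers ζ)
    rw [map_mul, map_inv, map_inv, mul_inv_eq_one] at this
    exact this


/-! ### Normalizers, presentations and orders for cyclic extensions -/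

section Generic

variable {H K : Type*} [Group H] [Group K]

theorem IsPresentedBy.closure_pair_eq_top {a b : H} {rels : Set (FreeGroup (Fin 2))}
    (h : IsPresentedBy ![a, b] rels) : Subgroup.closure {a, b} = ⊤ := by
  have h1 := MonoidHom.range_eq_top.mpr h.1
  rw [FreeGroup.range_lift_eq_closure] at h1
  rw [← h1]; congr 1; simp [Set.pair_comm]

theorem exists_zpow_zpow_eq {x : H} {s : ℤ} (h : IsCoprime s (orderOf x : ℤ)) :
    ∃ t : ℤ, (x ^ s) ^ t = x := by
  obtain ⟨t, k, hk⟩ := h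
  refine ⟨t, ?_⟩
  have h1 : x ^ (t * s + k * orderOf x) = x := by rw [hk, zpow_one]
  rwa [zpow_add, mul_comm k, zpow_mul x (orderOf x : ℤ), zpow_natCast, pow_orderOf_eq_one, one_zpow,
    mul_one, mul_comm t, zpow_mul] at h1

/-- Coprimality makes `x` and `y` powers of their `z`-conjugates, so conjugation by `z⁻¹` preserves
the subgroup as well. -/
theorem mem_normalizer_closure_pair {x y z : H} {s t : ℤ} (hx : rconj x z = x ^ s)
    (hy : rconj y z = y ^ t) (hs : IsCoprime s (orderOf x : ℤ))
    (ht : IsCoprime t (orderOf y : ℤ)) :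
    z ∈ Subgroup.normalizer (Subgroup.closure {x, y} : Set H) := by
  set V := Subgroup.closure {x, y} with hV
  have hxV : x ∈ V := Subgroup.subset_closure (by simp)
  have hyV : y ∈ V := Subgroup.subset_closure (by simp)
  have h1 : V ≤ V.comap (MulAut.conj z⁻¹).toMonoidHom := by
    rw [hV, Subgroup.closure_le, ← hV]
    rintro w (rfl | rfl)
    · have : z⁻¹ * w * z = w ^ s := hx
      simpa [this] using Subgroup.zpow_mem _ hxV s
    · have : z⁻¹ * w * z = w ^ t := hy
      simpa [this] using Subgroup.zpow_mem _ hyV t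
  have hroot {w : H} {s : ℤ} (hw : w ∈ V) (h : rconj w z = w ^ s)
      (hs : IsCoprime s (orderOf w : ℤ)) : z * w * z⁻¹ ∈ V := by
    obtain ⟨k, hk⟩ := exists_zpow_zpow_eq hs
    have h2 : z * w * z⁻¹ = w ^ k := by
      nth_rewrite 1 [← hk]
      rw [← h, ← rconj_zpow_left, rconj]; group
    rw [h2]; exact Subgroup.zpow_mem _ hw k
  have h2 : V ≤ V.comap (MulAut.conj z).toMonoidHom := by
    rw [hV, Subgroup.closure_le, ← hV]
    rintro w (rfl | rfl)
    · simpa using hroot hxV hx hs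
    · simpa using hroot hyV hy ht
  rw [Subgroup.mem_normalizer_iff]
  intro w
  refine ⟨fun hw => by simpa using h2 hw, fun hw => ?_⟩
  have := h1 hw
  simpa [mul_assoc] using this

theorem IsCoprime.of_zpow_mul_eq {b : H} {β μ : ℤ} (h : b ^ (β * μ) = b) :
    IsCoprime μ (orderOf b : ℤ) := by
  have h1 : b ^ (β * μ - 1) = 1 := by rw [zpow_sub, h, zpow_one, mul_inv_cancel]
  obtain ⟨t, ht⟩ := orderOf_dvd_iff_zpow_eq_one.mpr h1
  exact ⟨β, -t, by linear_combination ht⟩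

theorem isCoprime_orderOf_map {b : H} {μ : ℤ} (h : IsCoprime μ (orderOf b : ℤ)) (f : H →* K) :
    IsCoprime μ (orderOf (f b) : ℤ) :=
  h.of_isCoprime_of_dvd_right (by exact_mod_cast orderOf_map_dvd f b)

/-- A finite nilpotent group generated by `p`-elements is a `p`-group. -/
theorem isPGroup_of_closure_eq_top [Finite H] [Group.IsNilpotent H] {p : ℕ} [Fact p.Prime]
    {S : Set H} (hS : Subgroup.closure S = ⊤) (h : ∀ x ∈ S, ∃ k : ℕ, x ^ p ^ k = 1) :
    IsPGroup p H := by
  obtain ⟨P⟩ : Nonempty (Sylow p H) := inferInstance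
  have hP : (P : Subgroup H) = ⊤ := by
    rw [eq_top_iff, ← hS, Subgroup.closure_le]
    intro x hx
    obtain ⟨k, hk⟩ := h x hx
    have hz : IsPGroup p (Subgroup.zpowers x) := by
      refine IsPGroup.of_card (n := (Nat.card (Subgroup.zpowers x)).factorization p) ?_
      rw [Nat.card_zpowers]
      obtain ⟨j, _, hj⟩ := (Nat.dvd_prime_pow Fact.out).mp (orderOf_dvd_of_pow_eq_one hk)
      rw [hj, Nat.Prime.factorization_pow Fact.out]; simp
    obtain ⟨Q, hQ⟩ := hz.exists_le_sylow
    have := Sylow.unique_of_normal P inferInstance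
    rw [Subsingleton.elim P Q]
    exact hQ (Subgroup.mem_zpowers x)
  have := P.2
  rw [hP] at this
  exact this.of_equiv Subgroup.topEquiv

/-- A presentation of a cyclic extension. -/
theorem isPresentedBy_extension {α β μ : ℤ} {γ u v e m q : ℕ} {E T : Type*} [Group E] [Group T]
    {a b : E} (hE : IsPresentedBy ![a, b]
      (sylowRelators α β γ u v (FreeGroup.of (0 : Fin 2)) (FreeGroup.of (1 : Fin 2)) ∪
        commElements α μ γ (FreeGroup.of (0 : Fin 2)) (FreeGroup.of (1 : Fin 2))))
    (hα : IsCoprime α (orderOf a : ℤ)) (hμ : IsCoprime μ (orderOf b : ℤ))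
    (ι : E →* T) (hι : Function.Injective ι) (d : T)
    (had : rconj (ι a) d = ι a ^ (α ^ e)) (hbd : rconj (ι b) d = ι b ^ (μ ^ e))
    (hd : d ^ m = comm (ι a) (ι b) ^ q) (hgen : ∀ t : T, ∃ (x : E) (i : ℤ), t = ι x * d ^ i)
    (hord : ∀ i : ℤ, d ^ i ∈ ι.range → (m : ℤ) ∣ i) :
    IsPresentedBy ![ι a, ι b, d]
      (sylowRelators α β γ u v (FreeGroup.of (0 : Fin 3)) (FreeGroup.of (1 : Fin 3)) ∪
        commElements α μ γ (FreeGroup.of (0 : Fin 3)) (FreeGroup.of (1 : Fin 3)) ∪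
        extensionRelators α μ e m q (FreeGroup.of (0 : Fin 3)) (FreeGroup.of (1 : Fin 3))
          (FreeGroup.of (2 : Fin 3))) := by
  set rels := sylowRelators α β γ u v (FreeGroup.of (0 : Fin 3)) (FreeGroup.of (1 : Fin 3)) ∪
        commElements α μ γ (FreeGroup.of (0 : Fin 3)) (FreeGroup.of (1 : Fin 3)) ∪
        extensionRelators α μ e m q (FreeGroup.of (0 : Fin 3)) (FreeGroup.of (1 : Fin 3))
          (FreeGroup.of (2 : Fin 3)) with hrels
  have htop := hE.closure_pair_eq_top
  have hErel : ∀ r ∈ sylowRelators α β γ u v (FreeGroup.of (0 : Fin 2)) (FreeGroup.of (1 : Fin 2)) ∪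
        commElements α μ γ (FreeGroup.of (0 : Fin 2)) (FreeGroup.of (1 : Fin 2)),
      FreeGroup.lift ![a, b] r = 1 := by
    intro r hr
    rw [← MonoidHom.mem_ker, hE.2]
    exact Subgroup.subset_normalClosure hr
  have hle : Subgroup.normalClosure rels ≤ (FreeGroup.lift ![ι a, ι b, d]).ker := by
    refine Subgroup.normalClosure_le_normal ?_
    have himg : ∀ x ∈ sylowRelators α β γ u v (ι a) (ι b) ∪ commElements α μ γ (ι a) (ι b),
        x = 1 := by
      have e1 : sylowRelators α β γ u v (ι a) (ι b) ∪ commElements α μ γ (ι a) (ι b) =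
          (ι.comp (FreeGroup.lift ![a, b])) '' (sylowRelators α β γ u v (FreeGroup.of (0 : Fin 2))
            (FreeGroup.of (1 : Fin 2)) ∪
            commElements α μ γ (FreeGroup.of (0 : Fin 2)) (FreeGroup.of (1 : Fin 2))) := by
        rw [Set.image_union, image_sylowRelators, image_commElements]; simp
      rw [e1]
      rintro _ ⟨r, hr, rfl⟩
      rw [MonoidHom.comp_apply, hErel r hr, map_one]
    have hall : ∀ x ∈ FreeGroup.lift ![ι a, ι b, d] '' rels, x = 1 := by
      rw [hrels, Set.image_union, Set.image_union, image_sylowRelators, image_commElements,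
        image_extensionRelators]
      simp only [FreeGroup.lift_apply_of, Matrix.cons_val_zero, Matrix.cons_val_one,
        Matrix.cons_val]
      rintro x (hx | hx)
      · exact himg x hx
      · exact extensionRelators_eq_one_iff.mpr ⟨had, hbd, hd⟩ x hx
    exact fun r hr => hall _ ⟨r, hr, rfl⟩
  refine ⟨?_, le_antisymm ?_ hle⟩
  · rw [← MonoidHom.range_eq_top, eq_top_iff]
    have hmem (i : Fin 3) : ![ι a, ι b, d] i ∈ (FreeGroup.lift ![ι a, ι b, d]).range :=
      ⟨FreeGroup.of i, by simp⟩
    have hrange : ∀ x : E, ι x ∈ (FreeGroup.lift ![ι a, ι b, d]).range := by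
      have : (⊤ : Subgroup E) ≤ (FreeGroup.lift ![ι a, ι b, d]).range.comap ι := by
        rw [← htop, Subgroup.closure_le]
        rintro x (rfl | rfl)
        · exact hmem 0
        · exact hmem 1
      exact fun x => this (Subgroup.mem_top x)
    intro t _
    obtain ⟨x, i, rfl⟩ := hgen t
    exact Subgroup.mul_mem _ (hrange x) (Subgroup.zpow_mem _ (hmem 2) i)
  -- In the abstractly presented group the image of `E` under `σ` is normal, so every element is `σ
  -- x * d'^i`. If it dies in `T`, then `m ∣ i` by `hord`, the power of `d'` is absorbed into
  -- `σ.range`, and injectivity of `ι` concludes.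
  · intro w hw
    let mk := QuotientGroup.mk' (Subgroup.normalClosure rels)
    have hmk : ∀ x ∈ mk '' rels, x = 1 := by
      rintro _ ⟨r, hr, rfl⟩
      exact (QuotientGroup.eq_one_iff r).mpr (Subgroup.subset_normalClosure hr)
    have himage {K : Type} [Group K] (f : FreeGroup (Fin 3) →* K) : f '' rels =
        sylowRelators α β γ u v (f (FreeGroup.of 0)) (f (FreeGroup.of 1)) ∪
        commElements α μ γ (f (FreeGroup.of 0)) (f (FreeGroup.of 1)) ∪
        extensionRelators α μ e m q (f (FreeGroup.of 0)) (f (FreeGroup.of 1))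
          (f (FreeGroup.of 2)) := by
      rw [hrels, Set.image_union, Set.image_union, image_sylowRelators, image_commElements,
        image_extensionRelators]
    rw [himage] at hmk
    set a' := mk (FreeGroup.of 0)
    set b' := mk (FreeGroup.of 1)
    set d' := mk (FreeGroup.of 2)
    obtain ⟨h1, h2, h3⟩ := extensionRelators_eq_one_iff.mp fun x hx => hmk x (Or.inr hx)
    obtain ⟨σ, hσ⟩ := hE.exists_hom ![a', b'] (fun r hr => by
      have h4 : FreeGroup.lift ![a', b'] r ∈ sylowRelators α β γ u v a' b' ∪
          commElements α μ γ a' b' := by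
        have h5 := Set.mem_image_of_mem (FreeGroup.lift ![a', b']) hr
        rw [Set.image_union, image_sylowRelators, image_commElements] at h5
        simpa using h5
      exact hmk _ (Or.inl h4))
    have hσa : σ a = a' := by simpa using hσ 0
    have hσb : σ b = b' := by simpa using hσ 1
    have hσr : σ.range = Subgroup.closure {a', b'} := by
      rw [MonoidHom.range_eq_map, ← htop, MonoidHom.map_closure, Set.image_pair, hσa, hσb]
    have hdn : d' ∈ Subgroup.normalizer (σ.range : Set _) := by
      rw [hσr]
      refine mem_normalizer_closure_pair h1 h2 ?_ ?_
      · rw [← hσa]; exact (isCoprime_orderOf_map hα σ).pow_left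
      · rw [← hσb]; exact (isCoprime_orderOf_map hμ σ).pow_left
    have hnorm : σ.range.Normal := by
      rw [← Subgroup.normalizer_eq_top_iff, eq_top_iff]
      have h4 : Subgroup.closure (Set.range (fun i : Fin 3 => mk (FreeGroup.of i))) = ⊤ := by
        have h5 : Set.range (fun i : Fin 3 => mk (FreeGroup.of i)) =
            mk '' Set.range (FreeGroup.of : Fin 3 → _) := by
          rw [← Set.range_comp]; rfl
        rw [h5, ← MonoidHom.map_closure, FreeGroup.closure_range_of,
          Subgroup.map_top_of_surjective _ (QuotientGroup.mk'_surjective _)]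
      rw [← h4, Subgroup.closure_le]
      rintro _ ⟨i, rfl⟩
      fin_cases i
      · exact Subgroup.le_normalizer ⟨a, hσa⟩
      · exact Subgroup.le_normalizer ⟨b, hσb⟩
      · exact hdn
    have hall : ∀ g : FreeGroup (Fin 3), ∃ (x : E) (i : ℤ), mk g = σ x * d' ^ i := by
      have h4 : (⊤ : Subgroup (FreeGroup (Fin 3))) ≤ (σ.range ⊔ Subgroup.zpowers d').comap mk := by
        rw [← FreeGroup.closure_range_of, Subgroup.closure_le]
        rintro _ ⟨i, rfl⟩
        fin_cases i
        · exact Subgroup.mem_sup_left ⟨a, hσa⟩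
        · exact Subgroup.mem_sup_left ⟨b, hσb⟩
        · exact Subgroup.mem_sup_right (Subgroup.mem_zpowers d')
      intro g
      have h5 : mk g ∈ σ.range ⊔ Subgroup.zpowers d' := h4 (Subgroup.mem_top g)
      rw [← SetLike.mem_coe, Subgroup.normal_mul] at h5
      obtain ⟨_, ⟨x, rfl⟩, _, ⟨i, rfl⟩, h6⟩ := h5
      exact ⟨x, i, h6.symm⟩
    let τ : FreeGroup (Fin 3) ⧸ Subgroup.normalClosure rels →* T :=
      QuotientGroup.lift _ (FreeGroup.lift ![ι a, ι b, d]) hle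
    have hτ (g : FreeGroup (Fin 3)) : τ (mk g) = FreeGroup.lift ![ι a, ι b, d] g := rfl
    have hτσ (x : E) : τ (σ x) = ι x := by
      have : τ.comp σ = ι := by
        refine MonoidHom.eq_of_eqOn_dense htop ?_
        rintro x (rfl | rfl)
        · rw [MonoidHom.comp_apply, hσa, hτ]; simp
        · rw [MonoidHom.comp_apply, hσb, hτ]; simp
      rw [← this]; rfl
    have hτd : τ d' = d := by rw [hτ]; simp
    obtain ⟨x, i, hxi⟩ := hall w
    have hw1 : ι x * d ^ i = 1 := by
      rw [← hτσ, ← hτd, ← map_zpow, ← map_mul, ← hxi, hτ]; exact hw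
    obtain ⟨t, rfl⟩ := hord i ⟨x⁻¹, by rw [map_inv]; exact inv_eq_of_mul_eq_one_right hw1⟩
    have h5 : d' ^ ((m : ℤ) * t) = σ ((comm a b ^ q) ^ t) := by
      rw [zpow_mul, zpow_natCast, h3, map_zpow, map_pow, map_comm, hσa, hσb]
    rw [h5, ← map_mul] at hxi
    have h6 : x * (comm a b ^ q) ^ t = 1 := by
      apply hι
      rw [map_one, ← hτσ, ← hxi, hτ]; exact hw
    rw [h6, map_one] at hxi
    exact (QuotientGroup.eq_one_iff w).mp hxi

theorem isCyclic_and_card_quotient_range {E T : Type*} [Group E] [Group T] (ι : E →* T)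
    [ι.range.Normal] (d : T) (m : ℕ) (hd : d ^ m ∈ ι.range)
    (hgen : ∀ t : T, ∃ (x : E) (i : ℤ), t = ι x * d ^ i)
    (hord : ∀ i : ℤ, d ^ i ∈ ι.range → (m : ℤ) ∣ i) :
    IsCyclic (T ⧸ ι.range) ∧ Nat.card (T ⧸ ι.range) = m := by
  have h1 : ∀ t : T ⧸ ι.range, t ∈ Subgroup.zpowers (QuotientGroup.mk d : T ⧸ ι.range) := by
    intro t
    obtain ⟨t, rfl⟩ := QuotientGroup.mk_surjective t
    obtain ⟨x, i, rfl⟩ := hgen t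
    refine ⟨i, ?_⟩
    have : (QuotientGroup.mk (ι x) : T ⧸ ι.range) = 1 := (QuotientGroup.eq_one_iff _).mpr ⟨x, rfl⟩
    simp [this]
  refine ⟨⟨_, h1⟩, ?_⟩
  rw [← orderOf_eq_card_of_forall_mem_zpowers h1]
  refine Nat.dvd_antisymm ?_ ?_
  · rw [orderOf_dvd_iff_pow_eq_one, ← QuotientGroup.mk_pow]
    exact (QuotientGroup.eq_one_iff _).mpr hd
  · have h2 := pow_orderOf_eq_one (QuotientGroup.mk d : T ⧸ ι.range)
    rw [← QuotientGroup.mk_pow, QuotientGroup.eq_one_iff, ← zpow_natCast] at h2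
    exact_mod_cast hord _ h2

end Generic


theorem lconj_eq_of_rconj_eq {H : Type*} [Group H] {x y z : H} (h : rconj x z = y) :
    lconj z y = x := by
  rw [← h, rconj, lconj]; group

theorem rconj_eq_zpow_of_lconj_eq {H : Type*} [Group H] {y z : H} {β μ : ℤ}
    (h : lconj z y = y ^ β) (hμ : y ^ (β * μ) = y) : rconj y z = y ^ μ := by
  have h1 : rconj (y ^ β) z = y := by rw [← h, rconj, lconj]; group
  nth_rewrite 1 [← hμ]
  rw [zpow_mul, rconj_zpow_left, h1]

section Concrete

variable {α β : ℤ} {γ : ℕ}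

/-! ### The groups `G` and `W` -/

theorem macdonaldRel_A_B : MacdonaldRel (α ^ γ) (β ^ γ) (A α β γ) (B α β γ) := by
  have h (r) (hr : r ∈ macdonaldRelators (α ^ γ) (β ^ γ)
      (FreeGroup.of (0 : Fin 2)) (FreeGroup.of (1 : Fin 2))) :=
    PresentedGroup.one_of_mem hr
  refine ⟨?_, ?_⟩
  · have := h _ (Or.inl rfl)
    rw [map_mul, map_inv, mul_inv_eq_one, map_rconj, map_comm, map_zpow] at this
    exact this
  · have := h _ (Or.inr rfl)
    rw [map_mul, map_inv, mul_inv_eq_one, map_lconj, map_comm, map_zpow] at this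
    exact this

theorem closure_A_B : Subgroup.closure {A α β γ, B α β γ} = ⊤ := by
  rw [← PresentedGroup.closure_range_of]
  congr 1
  ext x
  simp only [Set.mem_insert_iff, Set.mem_singleton_iff, Set.mem_range, Fin.exists_fin_two, A, B,
    eq_comm]

theorem closure_X_Y_Z : Subgroup.closure {X α β γ, Y α β γ, Z α β γ} = ⊤ := by
  rw [← PresentedGroup.closure_range_of]
  congr 1
  ext x
  simp only [Set.mem_insert_iff, Set.mem_singleton_iff, Set.mem_range, X, Y,
    Z, eq_comm, Fin.exists_iff]
  constructor
  · rintro (rfl | rfl | rfl)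
    · exact ⟨0, by norm_num, rfl⟩
    · exact ⟨1, by norm_num, rfl⟩
    · exact ⟨2, by norm_num, rfl⟩
  · rintro ⟨i, hi, rfl⟩
    interval_cases i
    · exact Or.inl rfl
    · exact Or.inr (Or.inl rfl)
    · exact Or.inr (Or.inr rfl)

theorem Omega_A : Omega α β γ (A α β γ) = X α β γ := by
  simp [Omega, A]

theorem Omega_B : Omega α β γ (B α β γ) = Y α β γ := by
  simp [Omega, B]

theorem exists_hom_of_macdonaldRel {K : Type*} [Group K] {a b : K}
    (h : MacdonaldRel (α ^ γ) (β ^ γ) a b) :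
    ∃ φ : G α β γ →* K, φ (A α β γ) = a ∧ φ (B α β γ) = b := by
  suffices hrel : ∀ r ∈ macdonaldRelators (α ^ γ) (β ^ γ) (FreeGroup.of (0 : Fin 2))
      (FreeGroup.of (1 : Fin 2)), FreeGroup.lift ![a, b] r = 1 from
    ⟨PresentedGroup.toGroup hrel, by simp [A], by simp [B]⟩
  rintro r (rfl | rfl)
  · simpa [map_rconj, map_comm, mul_inv_eq_one] using h.left
  · simpa [map_lconj, map_comm, mul_inv_eq_one] using h.right

theorem exists_hom_of_wamsleyRel {K : Type*} [Group K] {x y z : K} (hx : rconj x z = x ^ α)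
    (hy : lconj z y = y ^ β) (hz : z ^ γ = comm x y) :
    ∃ φ : W α β γ →* K, φ (X α β γ) = x ∧ φ (Y α β γ) = y ∧ φ (Z α β γ) = z := by
  suffices hrel : ∀ r ∈ wamsleyRelators α β γ (FreeGroup.of (0 : Fin 3)) (FreeGroup.of (1 : Fin 3))
      (FreeGroup.of (2 : Fin 3)), FreeGroup.lift ![x, y, z] r = 1 from
    ⟨PresentedGroup.toGroup hrel, by simp [X], by simp [Y], by simp [Z]⟩
  rintro r (rfl | rfl | rfl)
  · simpa [map_rconj, mul_inv_eq_one] using hx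
  · simpa [map_lconj, mul_inv_eq_one] using hy
  · simpa [map_comm, mul_inv_eq_one] using hz

theorem hom_ext_A_B {K : Type*} [Group K] {f g : G α β γ →* K} (hA : f (A α β γ) = g (A α β γ))
    (hB : f (B α β γ) = g (B α β γ)) : f = g := by
  refine MonoidHom.eq_of_eqOn_dense closure_A_B ?_
  rintro x (rfl | rfl) <;> assumption

theorem range_Omega : (Omega α β γ).range = Subgroup.closure {X α β γ, Y α β γ} := by
  rw [MonoidHom.range_eq_map, ← closure_A_B, MonoidHom.map_closure, Set.image_pair, Omega_A,
    Omega_B]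

theorem finite_and_isNilpotent_G (hα : α ^ γ ≠ 1) (hβ : β ^ γ ≠ 1) :
    Finite (G α β γ) ∧ Group.IsNilpotent (G α β γ) :=
  macdonaldRel_A_B.finite_and_isNilpotent closure_A_B hα hβ

theorem isCoprime_orderOf_A [Finite (G α β γ)] (hγ : 0 < γ) :
    IsCoprime α (orderOf (A α β γ) : ℤ) :=
  (IsCoprime.pow_left_iff hγ).mp (macdonaldRel_A_B.isCoprime_orderOf (orderOf_pos _).ne')

theorem isCoprime_orderOf_B [Finite (G α β γ)] (hγ : 0 < γ) :
    IsCoprime β (orderOf (B α β γ) : ℤ) :=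
  (IsCoprime.pow_left_iff hγ).mp (macdonaldRel_A_B.symm.isCoprime_orderOf (orderOf_pos _).ne')

/-! ### The Sylow subgroup of `G` -/

variable {p : ℕ} [Fact p.Prime] {P : Sylow p (G α β γ)} {π : G α β γ →* P} {e : ℕ}

/-- The presented group is finite nilpotent by Macdonald's theorem and generated by `p`-elements,
hence a `p`-group, and it is a quotient of `G`. A word trivial in `P` has trivial `e`-th power in
`G`, and `e`-th powers detect triviality in a `p`-group. -/
theorem isPresentedBy_sylow (hα : α ^ γ ≠ 1) (hβ : β ^ γ ≠ 1) (hsurj : Function.Surjective π)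
    (hπ : ∀ g, (π g : G α β γ) = g ^ e) (he : e ≡ 1 [MOD p]) :
    IsPresentedBy ![π (A α β γ), π (B α β γ)]
      (sylowRelators α β γ (orderOf (π (A α β γ))) (orderOf (π (B α β γ)))
        (FreeGroup.of (0 : Fin 2)) (FreeGroup.of (1 : Fin 2))) := by
  obtain ⟨_, _⟩ := finite_and_isNilpotent_G hα hβ
  set a := π (A α β γ) with ha
  set b := π (B α β γ) with hb
  set rels := sylowRelators α β γ (orderOf a) (orderOf b)
        (FreeGroup.of (0 : Fin 2)) (FreeGroup.of (1 : Fin 2)) with hrels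
  have hab : MacdonaldRel (α ^ γ) (β ^ γ) a b := macdonaldRel_A_B.map π
  have htop : Subgroup.closure {a, b} = ⊤ := by
    rw [ha, hb, ← Set.image_pair, ← MonoidHom.map_closure, closure_A_B,
      Subgroup.map_top_of_surjective _ hsurj]
  refine ⟨?_, le_antisymm ?_ ?_⟩
  · rw [← MonoidHom.range_eq_top, FreeGroup.range_lift_eq_closure, ← htop]
    congr 1; simp [Set.pair_comm]
  · intro w hw
    have himage {K : Type} [Group K] (f : FreeGroup (Fin 2) →* K) : f '' rels =
        sylowRelators α β γ (orderOf a) (orderOf b) (f (FreeGroup.of 0)) (f (FreeGroup.of 1)) := by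
      rw [hrels, image_sylowRelators]
    let mk := QuotientGroup.mk' (Subgroup.normalClosure rels)
    have hmk : ∀ x ∈ mk '' rels, x = 1 := by
      rintro _ ⟨r, hr, rfl⟩
      exact (QuotientGroup.eq_one_iff r).mpr (Subgroup.subset_normalClosure hr)
    rw [himage] at hmk
    obtain ⟨h1, h2, h3⟩ := sylowRelators_eq_one_iff.mp hmk
    have htop' : Subgroup.closure {mk (FreeGroup.of 0), mk (FreeGroup.of 1)} = ⊤ := by
      have h4 : ({FreeGroup.of 0, FreeGroup.of 1} : Set (FreeGroup (Fin 2))) =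
          Set.range FreeGroup.of := by
        ext x; simp [Fin.exists_fin_two, eq_comm]
      rw [← Set.image_pair, ← MonoidHom.map_closure, h4, FreeGroup.closure_range_of,
        Subgroup.map_top_of_surjective _ (QuotientGroup.mk'_surjective _)]
    obtain ⟨_, _⟩ := h1.finite_and_isNilpotent htop' hα hβ
    have hpow (x : P) : ∃ k, orderOf x = p ^ k := by
      obtain ⟨k, hk⟩ := P.2 x
      obtain ⟨j, _, hj⟩ := (Nat.dvd_prime_pow Fact.out).mp (orderOf_dvd_of_pow_eq_one hk)
      exact ⟨j, hj⟩
    have hpg : IsPGroup p (FreeGroup (Fin 2) ⧸ Subgroup.normalClosure rels) := by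
      refine isPGroup_of_closure_eq_top htop' ?_
      rintro x (rfl | rfl)
      · obtain ⟨k, hk⟩ := hpow a
        exact ⟨k, hk ▸ h2⟩
      · obtain ⟨k, hk⟩ := hpow b
        exact ⟨k, hk ▸ h3⟩
    obtain ⟨φ, hφA, hφB⟩ := exists_hom_of_macdonaldRel h1
    have hφ : φ.comp (FreeGroup.lift ![A α β γ, B α β γ]) = mk := by
      ext i; fin_cases i <;> simp [hφA, hφB]
    have hπw : π.comp (FreeGroup.lift ![A α β γ, B α β γ]) = FreeGroup.lift ![a, b] := by
      ext i; fin_cases i <;> simp [ha, hb]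
    rw [MonoidHom.mem_ker, ← hπw, MonoidHom.comp_apply] at hw
    have h4 := hπ (FreeGroup.lift ![A α β γ, B α β γ] w)
    rw [hw] at h4
    have h5 : mk w ^ e = 1 := by
      rw [← hφ, MonoidHom.comp_apply, ← map_pow, ← h4]; simp
    exact (QuotientGroup.eq_one_iff w).mp (IsPGroup.eq_one_of_pow_eq_one hpg he h5)
  · refine Subgroup.normalClosure_le_normal fun r hr => ?_
    have h1 := Set.mem_image_of_mem (FreeGroup.lift ![a, b]) hr
    rw [hrels, image_sylowRelators] at h1
    exact sylowRelators_eq_one_iff.mpr ⟨hab, pow_orderOf_eq_one a, pow_orderOf_eq_one b⟩ _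
      (by simpa using h1)

/-! ### Mapping `W` to cyclic extensions -/

/-- The relations of `E` are exactly what makes `a ↦ a^α`, `b ↦ b^μ` an automorphism `θ` fixing
`[a,b]`, with `θ^γ` conjugation by `[a,b]`. In the resulting cyclic extension the new element plays
the role of `Z`. -/
theorem exists_hom_W_extension.{w} {μ : ℤ} {u v : ℕ} (hγ : 0 < γ) {E : Type w} [Group E] [Finite E]
    {a b : E} (hE : IsPresentedBy ![a, b]
      (sylowRelators α β γ u v (FreeGroup.of (0 : Fin 2)) (FreeGroup.of (1 : Fin 2)) ∪
        commElements α μ γ (FreeGroup.of (0 : Fin 2)) (FreeGroup.of (1 : Fin 2))))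
    (hα : IsCoprime α (orderOf a : ℤ)) (hμ : b ^ (β * μ) = b) :
    ∃ (F : Type w) (_ : Group F) (j : E →* F) (ψ : W α β γ →* F), Function.Injective j ∧
      ψ (X α β γ) = j a ∧ ψ (Y α β γ) = j b := by
  have hrel : ∀ x ∈ sylowRelators α β γ u v a b ∪ commElements α μ γ a b, x = 1 := by
    have e1 : sylowRelators α β γ u v a b ∪ commElements α μ γ a b =
        FreeGroup.lift ![a, b] '' (sylowRelators α β γ u v (FreeGroup.of (0 : Fin 2))
          (FreeGroup.of (1 : Fin 2)) ∪
          commElements α μ γ (FreeGroup.of (0 : Fin 2)) (FreeGroup.of (1 : Fin 2))) := by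
      rw [Set.image_union, image_sylowRelators, image_commElements]; simp
    rw [e1]
    rintro _ ⟨r, hr, rfl⟩
    rw [← MonoidHom.mem_ker, hE.2]
    exact Subgroup.subset_normalClosure hr
  have htop := hE.closure_pair_eq_top
  obtain ⟨hmac, hu, hv⟩ := sylowRelators_eq_one_iff.mp fun x hx => hrel x (Or.inl hx)
  have hcomm := commElements_eq_one_iff.mp fun x hx => hrel x (Or.inr hx)
  have hra : a ^ (α ^ γ) = rconj a (comm a b) := hmac.left.symm
  have hμn (n : ℕ) : b ^ (β ^ n * μ ^ n) = b := by
    rw [← mul_pow]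
    induction n with
    | zero => simp
    | succ n ih => rw [pow_succ, zpow_mul, ih, hμ]
  have hrb : b ^ (μ ^ γ) = rconj b (comm a b) := by
    have h1 : rconj (b ^ (β ^ γ)) (comm a b) = b := by
      rw [← hmac.right]; simp only [rconj, lconj]; group
    have h2 := congrArg (· ^ (μ ^ γ)) h1
    simp only [← rconj_zpow_left, ← zpow_mul, hμn] at h2
    exact h2.symm
  -- The case `i = γ` is automatic, both entries being conjugates by `[a,b]`. It is needed because
  -- applying `θ` shifts the index by one.
  have hcomm' (i : ℕ) (hi : i ≤ γ) : comm (a ^ (α ^ i)) (b ^ (μ ^ i)) = comm a b := by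
    rcases Nat.eq_zero_or_pos i with rfl | h0
    · simp
    rcases hi.lt_or_eq with h | rfl
    · exact hcomm i h0 h
    · rw [hra, hrb, ← rconj_comm]; simp [rconj]
  have hc1 : comm (a ^ α) (b ^ μ) = comm a b := by simpa using hcomm' 1 hγ
  obtain ⟨θ, hθ⟩ := hE.exists_hom ![a ^ α, b ^ μ] (by
    intro r hr
    have h4 : FreeGroup.lift ![a ^ α, b ^ μ] r ∈ sylowRelators α β γ u v (a ^ α) (b ^ μ) ∪
        commElements α μ γ (a ^ α) (b ^ μ) := by
      have h5 := Set.mem_image_of_mem (FreeGroup.lift ![a ^ α, b ^ μ]) hr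
      rw [Set.image_union, image_sylowRelators, image_commElements] at h5
      simpa using h5
    rcases h4 with h4 | h4
    · refine sylowRelators_eq_one_iff.mpr ⟨⟨?_, ?_⟩, ?_, ?_⟩ _ h4
      · rw [hc1, rconj_zpow_left, hmac.left, ← zpow_mul, ← zpow_mul, mul_comm]
      · rw [hc1, lconj_eq_rconj_inv, rconj_zpow_left, ← lconj_eq_rconj_inv, hmac.right,
          ← zpow_mul, ← zpow_mul, mul_comm]
      · rw [← zpow_natCast, zpow_comm, zpow_natCast, hu, one_zpow]
      · rw [← zpow_natCast, zpow_comm, zpow_natCast, hv, one_zpow]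
    · refine commElements_eq_one_iff.mpr (fun i _ hi => ?_) _ h4
      rw [← zpow_mul, ← zpow_mul, ← pow_succ', ← pow_succ', hcomm' _ hi, hc1])
  have hθa : θ a = a ^ α := by simpa using hθ 0
  have hθb : θ b = b ^ μ := by simpa using hθ 1
  have hsurj : Function.Surjective θ := by
    rw [← MonoidHom.range_eq_top, eq_top_iff, ← htop, Subgroup.closure_le]
    rintro x (rfl | rfl)
    · obtain ⟨t, ht⟩ := exists_zpow_zpow_eq hα
      exact ⟨x ^ t, by rw [map_zpow, hθa, ht]⟩
    · exact ⟨x ^ β, by rw [map_zpow, hθb, ← zpow_mul, mul_comm, hμ]⟩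
  let Θ : MulAut E := MulEquiv.ofBijective θ ⟨Finite.injective_iff_surjective.mpr hsurj, hsurj⟩
  have hΘa (n : ℕ) : (Θ ^ n) a = a ^ (α ^ n) := by
    induction n with
    | zero => simp
    | succ n ih =>
      rw [pow_succ', MulAut.mul_apply, ih, map_zpow, show Θ a = a ^ α from hθa, ← zpow_mul,
        pow_succ']
  have hΘb (n : ℕ) : (Θ ^ n) b = b ^ (μ ^ n) := by
    induction n with
    | zero => simp
    | succ n ih =>
      rw [pow_succ', MulAut.mul_apply, ih, map_zpow, show Θ b = b ^ μ from hθb, ← zpow_mul,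
        pow_succ']
  obtain ⟨F, _, j, z, hj, hjz, hz⟩ := exists_cyclic_extension Θ (comm a b) hγ
    (by
      change θ (comm a b) = comm a b
      rw [map_comm, hθa, hθb, hc1])
    (by
      have : (Θ ^ γ).toMonoidHom = (MulAut.conj (comm a b)⁻¹).toMonoidHom := by
        refine MonoidHom.eq_of_eqOn_dense htop ?_
        rintro x (rfl | rfl)
        · simpa [rconj] using (hΘa γ).trans hra
        · simpa [rconj] using (hΘb γ).trans hrb
      intro x
      simpa [rconj] using DFunLike.congr_fun this x)
  obtain ⟨ψ, hψX, hψY, _⟩ := exists_hom_of_wamsleyRel (α := α) (β := β) (γ := γ) (x := j a)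
    (y := j b) (z := z)
    (by rw [← hjz, ← map_zpow]; exact congrArg j hθa)
    (by
      have h1 : rconj (j b ^ β) z = j b := by
        rw [rconj_zpow_left, ← hjz, ← map_zpow]
        change j (θ b ^ β) = j b
        rw [hθb, ← zpow_mul, mul_comm, hμ]
      exact lconj_eq_of_rconj_eq h1)
    (by rw [hz, map_comm])
  exact ⟨F, inferInstance, j, ψ, hj, hψX, hψY⟩

end Concrete

/-! ### The image of `Ω` in `W` and the determination of `N_p` -/

section Concrete

open scoped commutatorElement

variable {α β : ℤ} {γ : ℕ}

theorem normal_of_X_Y_Z_mem {V : Subgroup (W α β γ)}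
    (hX : X α β γ ∈ Subgroup.normalizer (V : Set (W α β γ)))
    (hY : Y α β γ ∈ Subgroup.normalizer (V : Set (W α β γ)))
    (hZ : Z α β γ ∈ Subgroup.normalizer (V : Set (W α β γ))) : V.Normal := by
  rw [← Subgroup.normalizer_eq_top_iff, eq_top_iff, ← closure_X_Y_Z, Subgroup.closure_le]
  rintro x (rfl | rfl | rfl) <;> assumption

theorem Z_mem_normalizer {x y : W α β γ} (hx : rconj x (Z α β γ) = x ^ α)
    (hy : lconj (Z α β γ) y = y ^ β) (hα : IsCoprime α (orderOf x : ℤ))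
    (hβ : IsCoprime β (orderOf y : ℤ)) :
    Z α β γ ∈ Subgroup.normalizer (Subgroup.closure {x, y} : Set (W α β γ)) := by
  obtain ⟨μ, hμ⟩ := exists_zpow_zpow_eq hβ
  rw [← zpow_mul] at hμ
  exact mem_normalizer_closure_pair hx (rconj_eq_zpow_of_lconj_eq hy hμ) hα
    (IsCoprime.of_zpow_mul_eq hμ)

theorem normal_range_Omega [Finite (G α β γ)] (hγ : 0 < γ) : (Omega α β γ).range.Normal := by
  refine normal_of_X_Y_Z_mem (Subgroup.le_normalizer ⟨_, Omega_A⟩)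
    (Subgroup.le_normalizer ⟨_, Omega_B⟩) ?_
  rw [range_Omega]
  refine Z_mem_normalizer (X_rel α β γ) (Y_rel α β γ) ?_ ?_
  · rw [← Omega_A]; exact isCoprime_orderOf_map (isCoprime_orderOf_A hγ) _
  · rw [← Omega_B]; exact isCoprime_orderOf_map (isCoprime_orderOf_B hγ) _

theorem index_range_Omega_dvd [Finite (G α β γ)] (hγ : 0 < γ) :
    (Omega α β γ).range.index ∣ γ := by
  have := normal_range_Omega (α := α) (β := β) hγ
  set R := (Omega α β γ).range
  let mk := QuotientGroup.mk' R
  have hX : mk (X α β γ) = 1 := (QuotientGroup.eq_one_iff _).mpr ⟨_, Omega_A⟩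
  have hY : mk (Y α β γ) = 1 := (QuotientGroup.eq_one_iff _).mpr ⟨_, Omega_B⟩
  have htop : ∀ t, t ∈ Subgroup.zpowers (mk (Z α β γ)) := by
    have h1 : (⊤ : Subgroup (W α β γ)) ≤ (Subgroup.zpowers (mk (Z α β γ))).comap mk := by
      rw [← closure_X_Y_Z, Subgroup.closure_le]
      rintro x (rfl | rfl | rfl)
      · simp [hX]
      · simp [hY]
      · simp
    intro t
    obtain ⟨t, rfl⟩ := QuotientGroup.mk'_surjective R t
    exact h1 (Subgroup.mem_top t)
  rw [Subgroup.index_eq_card, ← orderOf_eq_card_of_forall_mem_zpowers htop,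
    orderOf_dvd_iff_pow_eq_one, ← map_pow, Z_rel, map_comm, hX, hY]
  simp [comm]

theorem finite_W [Finite (G α β γ)] (hγ : 0 < γ) : Finite (W α β γ) := by
  have : (Omega α β γ).range.FiniteIndex :=
    ⟨fun h => hγ.ne' (Nat.eq_zero_of_zero_dvd (h ▸ index_range_Omega_dvd hγ))⟩
  have : Finite (Omega α β γ).range :=
    Finite.of_surjective _ (Omega α β γ).rangeRestrict_surjective
  exact Finite.of_subgroup_quotient (Omega α β γ).range

/-- Detected by the homomorphism from `W` to `ℤ/γ` that kills `X` and `Y` and sends `Z` to `1`. -/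
theorem dvd_of_Z_zpow_mem {i : ℤ} (h : Z α β γ ^ i ∈ (Omega α β γ).range) : (γ : ℤ) ∣ i := by
  obtain ⟨χ, hX, hY, hZ⟩ := exists_hom_of_wamsleyRel (α := α) (β := β) (γ := γ)
    (K := Multiplicative (ZMod γ)) (x := 1) (y := 1) (z := Multiplicative.ofAdd 1)
    (by simp [rconj]) (by simp [lconj]) (by
      rw [← ofAdd_nsmul, nsmul_one, ZMod.natCast_self]; simp [comm])
  have hle : (Omega α β γ).range ≤ χ.ker := by
    rw [range_Omega, Subgroup.closure_le]
    rintro x (rfl | rfl) <;> assumption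
  have h1 := hle h
  rw [MonoidHom.mem_ker, map_zpow, hZ, ← ofAdd_zsmul, ofAdd_eq_one, zsmul_one,
    ZMod.intCast_zmod_eq_zero_iff_dvd] at h1
  exact h1

variable {p : ℕ} {P : Sylow p (G α β γ)} {π : G α β γ →* P} {e : ℕ}

theorem Omega_projection_A (hπ : ∀ g, (π g : G α β γ) = g ^ e) :
    Omega α β γ (π (A α β γ)) = X α β γ ^ e := by
  rw [hπ, map_pow, Omega_A]

theorem Omega_projection_B (hπ : ∀ g, (π g : G α β γ) = g ^ e) :
    Omega α β γ (π (B α β γ)) = Y α β γ ^ e := by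
  rw [hπ, map_pow, Omega_B]

theorem rconj_X_pow (e : ℕ) : rconj (X α β γ ^ e) (Z α β γ) = (X α β γ ^ e) ^ α := by
  rw [← zpow_natCast, rconj_zpow_left, X_rel, zpow_comm]

theorem lconj_Y_pow (e : ℕ) : lconj (Z α β γ) (Y α β γ ^ e) = (Y α β γ ^ e) ^ β := by
  rw [← zpow_natCast, lconj_eq_rconj_inv, rconj_zpow_left, ← lconj_eq_rconj_inv, Y_rel, zpow_comm]

theorem comm_X_pow_Y_pow (hπ : ∀ g, (π g : G α β γ) = g ^ e) :
    comm (X α β γ ^ e) (Y α β γ ^ e) = Z α β γ ^ (γ * e) := by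
  have h1 := hπ (comm (A α β γ) (B α β γ))
  have h2 := congrArg (Omega α β γ) h1
  rw [map_pow, map_comm (Omega α β γ), Omega_A, Omega_B, ← Z_rel, ← pow_mul] at h2
  have h3 := map_comm ((Omega α β γ).comp (P : Subgroup (G α β γ)).subtype) (π (A α β γ))
    (π (B α β γ))
  simp only [MonoidHom.comp_apply, Subgroup.subtype_apply] at h3
  rw [← h2, map_comm π, h3, Omega_projection_A hπ, Omega_projection_B hπ]

/-- An equation between images in `P / N_p` amounts to one between images in `W`. -/
theorem mk_eq_mk_iff (x y : P) : (QuotientGroup.mk x : P ⧸ Np P) = QuotientGroup.mk y ↔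
    Omega α β γ x = Omega α β γ y := by
  rw [QuotientGroup.eq, Subgroup.mem_subgroupOf, MonoidHom.mem_ker]
  simp [inv_mul_eq_one]

theorem Y_pow_zpow_eq (hπ : ∀ g, (π g : G α β γ) = g ^ e) {μ : ℤ}
    (hμ : (QuotientGroup.mk (π (B α β γ)) : P ⧸ Np P) ^ (β * μ) = QuotientGroup.mk (π (B α β γ))) :
    (Y α β γ ^ e) ^ (β * μ) = Y α β γ ^ e := by
  rw [← QuotientGroup.mk_zpow, mk_eq_mk_iff] at hμ
  rwa [Subgroup.coe_zpow, map_zpow, Omega_projection_B hπ] at hμ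

/-- In `W`, conjugation by `Z^i` raises `X^e` to the `α^i` and `Y^e` to the `μ^i`, but fixes their
commutator, which is a power of `Z`. -/
theorem normalClosure_commElements_le (hπ : ∀ g, (π g : G α β γ) = g ^ e) {μ : ℤ}
    (hμ : (QuotientGroup.mk (π (B α β γ)) : P ⧸ Np P) ^ (β * μ) = QuotientGroup.mk (π (B α β γ))) :
    Subgroup.normalClosure (commElements α μ γ (π (A α β γ)) (π (B α β γ))) ≤ Np P := by
  refine Subgroup.normalClosure_le_normal ?_
  have h1 := rconj_eq_zpow_of_lconj_eq (lconj_Y_pow e) (Y_pow_zpow_eq hπ hμ)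
  have h2 : ∀ x ∈ commElements α μ γ (X α β γ ^ e) (Y α β γ ^ e), x = 1 := by
    refine commElements_eq_one_iff.mpr fun i _ _ => ?_
    rw [← rconj_pow h1, ← rconj_pow (rconj_X_pow e), ← rconj_comm, comm_X_pow_Y_pow hπ, rconj,
      mul_assoc, ← pow_add, add_comm, pow_add, inv_mul_cancel_left]
  intro x hx
  have h3 := Set.mem_image_of_mem ((Omega α β γ).comp (P : Subgroup (G α β γ)).subtype) hx
  rw [image_commElements] at h3
  simp only [MonoidHom.comp_apply, Subgroup.subtype_apply] at h3
  rw [Omega_projection_A hπ, Omega_projection_B hπ] at h3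
  exact h2 _ h3

variable [Fact p.Prime]

/-- The projection of `G` to `P/M`, followed by the embedding into the cyclic extension, factors
through `Ω`; so elements of `P` killed by `Ω` lie in `M`. -/
theorem Np_le_normalClosure_of_orderOf (hγ : 0 < γ) (hα : α ^ γ ≠ 1) (hβ : β ^ γ ≠ 1)
    (hid : ∀ g : P, π g = g) (hπ : ∀ g, (π g : G α β γ) = g ^ e) (he : e ≡ 1 [MOD p]) {μ : ℤ}
    (hμ : π (B α β γ) ^ (β * μ) = π (B α β γ)) :
    Np P ≤ Subgroup.normalClosure (commElements α μ γ (π (A α β γ)) (π (B α β γ))) := by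
  obtain ⟨_, _⟩ := finite_and_isNilpotent_G hα hβ
  set a := π (A α β γ)
  set b := π (B α β γ)
  set M := Subgroup.normalClosure (commElements α μ γ a b) with hM
  have hP := isPresentedBy_sylow hα hβ (fun g => ⟨g, hid g⟩) hπ he
  have hE := hP.quotient (commElements α μ γ (FreeGroup.of (0 : Fin 2)) (FreeGroup.of (1 : Fin 2)))
    M (by rw [image_commElements]; simp [hM, a, b])
  have hvec : (fun i => (QuotientGroup.mk (![a, b] i) : P ⧸ M)) =
      ![QuotientGroup.mk a, QuotientGroup.mk b] := by
    funext i; fin_cases i <;> rfl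
  rw [hvec] at hE
  have hco : IsCoprime α (orderOf (QuotientGroup.mk a : P ⧸ M) : ℤ) :=
    isCoprime_orderOf_map (isCoprime_orderOf_A hγ) ((QuotientGroup.mk' M).comp π)
  obtain ⟨F, _, j, ψ, hj, hψX, hψY⟩ := exists_hom_W_extension hγ hE hco
    (by rw [← QuotientGroup.mk_zpow, hμ])
  have hcomp : ψ.comp (Omega α β γ) = j.comp ((QuotientGroup.mk' M).comp π) := by
    refine hom_ext_A_B ?_ ?_
    · rw [MonoidHom.comp_apply, Omega_A, hψX]; rfl
    · rw [MonoidHom.comp_apply, Omega_B, hψY]; rfl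
  intro g hg
  have h1 : Omega α β γ g = 1 := hg
  have h2 := DFunLike.congr_fun hcomp (g : G α β γ)
  rw [MonoidHom.comp_apply, h1, map_one, MonoidHom.comp_apply, MonoidHom.comp_apply, hid] at h2
  exact (QuotientGroup.eq_one_iff g).mp (hj (h2.symm.trans (map_one j).symm))

/-- Let `ν` be inverse to `β` modulo the order of `b`. Then `b^(ν^i)` and `b^(μ^i)` differ by an
element of `N_p`, central modulo `[N_p, P]`, so the commutators formed with `ν` and with `μ` agree
there. Hence `N_p ≤ M [N_p, P]`, and nilpotency gives `N_p ≤ M`. -/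
theorem Np_eq_normalClosure (hγ : 0 < γ) (hα : α ^ γ ≠ 1) (hβ : β ^ γ ≠ 1)
    (hid : ∀ g : P, π g = g) (hπ : ∀ g, (π g : G α β γ) = g ^ e) (he : e ≡ 1 [MOD p]) {μ : ℤ}
    (hμ : (QuotientGroup.mk (π (B α β γ)) : P ⧸ Np P) ^ (β * μ) = QuotientGroup.mk (π (B α β γ))) :
    Np P = Subgroup.normalClosure (commElements α μ γ (π (A α β γ)) (π (B α β γ))) := by
  obtain ⟨_, _⟩ := finite_and_isNilpotent_G hα hβ
  refine le_antisymm ?_ (normalClosure_commElements_le hπ hμ)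
  have hnil : Group.IsNilpotent P := P.2.isNilpotent
  apply le_of_le_sup_commutator_top
  obtain ⟨ν, hν⟩ := exists_zpow_zpow_eq
    (isCoprime_orderOf_map (isCoprime_orderOf_B (α := α) (β := β) hγ) π)
  rw [← zpow_mul] at hν
  refine (Np_le_normalClosure_of_orderOf hγ hα hβ hid hπ he hν).trans ?_
  set a := π (A α β γ)
  set b := π (B α β γ)
  set M := Subgroup.normalClosure (commElements α μ γ a b) with hM
  refine Subgroup.normalClosure_le_normal ?_
  rintro _ ⟨i, h1, h2, rfl⟩
  let f := QuotientGroup.mk' (M ⊔ ⁅Np P, ⊤⁆)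
  have hμν : (QuotientGroup.mk b : P ⧸ Np P) ^ μ = QuotientGroup.mk b ^ ν := by
    have e1 : (QuotientGroup.mk b : P ⧸ Np P) ^ (β * ν) = QuotientGroup.mk b := by
      rw [← QuotientGroup.mk_zpow, hν]
    calc (QuotientGroup.mk b : P ⧸ Np P) ^ μ
        = (QuotientGroup.mk b ^ (β * ν)) ^ μ := by rw [e1]
      _ = (QuotientGroup.mk b ^ (β * μ)) ^ ν := by rw [← zpow_mul, ← zpow_mul]; congr 1; ring
      _ = QuotientGroup.mk b ^ ν := by rw [hμ]
  have hpow (i : ℕ) : (QuotientGroup.mk b : P ⧸ Np P) ^ (μ ^ i) = QuotientGroup.mk b ^ (ν ^ i) := by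
    induction i with
    | zero => simp
    | succ i ih => rw [pow_succ, zpow_mul, ih, zpow_comm, hμν, ← zpow_mul, ← pow_succ']
  have hz : (b ^ (μ ^ i))⁻¹ * b ^ (ν ^ i) ∈ Np P := by
    rw [← QuotientGroup.eq, QuotientGroup.mk_zpow, QuotientGroup.mk_zpow, hpow]
  set z := (b ^ (μ ^ i))⁻¹ * b ^ (ν ^ i) with hzdef
  have hzc (g : P) : Commute (f z) (f g) := by
    have : f ⁅z, g⁆ = 1 := (QuotientGroup.eq_one_iff _).mpr
      (Subgroup.mem_sup_right (Subgroup.commutator_mem_commutator hz (Subgroup.mem_top g)))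
    rw [map_commutatorElement, commutatorElement_eq_one_iff_commute] at this
    exact this
  have hb : b ^ (ν ^ i) = b ^ (μ ^ i) * z := by rw [hzdef, mul_inv_cancel_left]
  have hcomm : f (comm (a ^ (α ^ i)) (b ^ (ν ^ i))) = f (comm (a ^ (α ^ i)) (b ^ (μ ^ i))) := by
    rw [hb, map_comm, map_comm, map_mul]
    have hc := hzc (a ^ (α ^ i))
    have hc' := hzc (b ^ (μ ^ i))
    generalize f (a ^ (α ^ i)) = x at hc ⊢
    generalize f (b ^ (μ ^ i)) = y at hc' ⊢
    generalize f z = w at hc hc' ⊢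
    have e1 : comm x (y * w) = x⁻¹ * w⁻¹ * (y⁻¹ * x * y) * w := by simp only [comm]; group
    have e2 : Commute w (y⁻¹ * x * y) := (hc'.inv_right.mul_right hc).mul_right hc'
    rw [e1, mul_assoc, ← e2.eq, ← mul_assoc, inv_mul_cancel_right, comm]; group
  have h3 : f (comm (a ^ (α ^ i)) (b ^ (μ ^ i)) * (comm a b)⁻¹) = 1 :=
    (QuotientGroup.eq_one_iff _).mpr
      (Subgroup.mem_sup_left (Subgroup.subset_normalClosure ⟨i, h1, h2, rfl⟩))
  rw [map_mul, ← hcomm, ← map_mul] at h3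
  exact (QuotientGroup.eq_one_iff _).mp h3

end Concrete

section Concrete

variable {α β : ℤ} {γ p : ℕ} {P : Sylow p (G α β γ)} {π : G α β γ →* P} {e : ℕ}

/-! ### The Sylow subgroups of `W` -/

theorem card_map_sylow : Nat.card ((P : Subgroup (G α β γ)).map (Omega α β γ)) =
    Nat.card (P ⧸ Np P) := by
  let ω := (Omega α β γ).comp (P : Subgroup (G α β γ)).subtype
  have h1 : ω.range = (P : Subgroup (G α β γ)).map (Omega α β γ) := by
    rw [MonoidHom.range_comp, Subgroup.range_subtype]
  rw [← h1]
  exact (Nat.card_congr (QuotientGroup.quotientKerEquivRange ω).toEquiv).symm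

variable [Fact p.Prime]

/-- `X` and `Y` normalize the image because `P` is normal in `G`; `Z` does because the image is
generated by `X^e` and `Y^e`. -/
theorem normal_map_sylow (hγ : 0 < γ) [Finite (G α β γ)] [Group.IsNilpotent (G α β γ)]
    (hsurj : Function.Surjective π) (hπ : ∀ g, (π g : G α β γ) = g ^ e) :
    ((P : Subgroup (G α β γ)).map (Omega α β γ)).Normal := by
  have hPn : (P : Subgroup (G α β γ)).Normal := inferInstance
  have hV : (P : Subgroup (G α β γ)).map (Omega α β γ) =
      Subgroup.closure {X α β γ ^ e, Y α β γ ^ e} := by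
    have h1 : (P : Subgroup (G α β γ)).map (Omega α β γ) =
        (((Omega α β γ).comp (P : Subgroup (G α β γ)).subtype).comp π).range := by
      rw [MonoidHom.range_comp, MonoidHom.range_eq_top.mpr hsurj, ← MonoidHom.range_eq_map,
        MonoidHom.range_comp, Subgroup.range_subtype]
    rw [h1, MonoidHom.range_eq_map, ← closure_A_B, MonoidHom.map_closure, Set.image_pair]
    simp only [MonoidHom.comp_apply, Subgroup.subtype_apply]
    rw [Omega_projection_A hπ, Omega_projection_B hπ]
  have hmem (g : G α β γ) : Omega α β γ g ∈ Subgroup.normalizer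
      ((P : Subgroup (G α β γ)).map (Omega α β γ) : Set (W α β γ)) := by
    have h1 := Subgroup.le_normalizer_map (H := (P : Subgroup (G α β γ))) (Omega α β γ)
    rw [Subgroup.normalizer_eq_top_iff.mpr hPn] at h1
    exact h1 ⟨g, Subgroup.mem_top g, rfl⟩
  refine normal_of_X_Y_Z_mem (Omega_A (α := α) (β := β) (γ := γ) ▸ hmem _)
    (Omega_B (α := α) (β := β) (γ := γ) ▸ hmem _) ?_
  rw [hV]
  refine Z_mem_normalizer (rconj_X_pow e) (lconj_Y_pow e) ?_ ?_
  · rw [← Omega_A, ← map_pow]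
    exact isCoprime_orderOf_map ((isCoprime_orderOf_A (β := β) hγ).of_isCoprime_of_dvd_right
      (Int.natCast_dvd_natCast.mpr (orderOf_pow_dvd e))) _
  · rw [← Omega_B, ← map_pow]
    exact isCoprime_orderOf_map ((isCoprime_orderOf_B (α := α) hγ).of_isCoprime_of_dvd_right
      (Int.natCast_dvd_natCast.mpr (orderOf_pow_dvd e))) _

theorem card_sylow_dvd (hγ : 0 < γ) [Finite (G α β γ)] {n k : ℕ} (hnk : γ = p ^ n * k)
    (hk : ¬ p ∣ k) (Q : Sylow p (W α β γ)) :
    Nat.card Q ∣ Nat.card ((P : Subgroup (G α β γ)).map (Omega α β γ)) * p ^ n := by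
  have := finite_W (α := α) (β := β) hγ
  set V := (P : Subgroup (G α β γ)).map (Omega α β γ)
  have hp : p.Prime := Fact.out
  have h1 : V.index ∣ (P : Subgroup (G α β γ)).index * γ := by
    rw [Subgroup.index_map]
    exact mul_dvd_mul (Subgroup.index_dvd_of_le le_sup_left) (index_range_Omega_dvd hγ)
  have h2 : Nat.card Q ∣ (Nat.card V * p ^ n) * ((P : Subgroup (G α β γ)).index * k) := by
    have h3 : Nat.card Q ∣ Nat.card V * V.index := by
      rw [Subgroup.card_mul_index]; exact Subgroup.card_subgroup_dvd_card _
    refine h3.trans ((mul_dvd_mul_left _ h1).trans (dvd_of_eq ?_))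
    linear_combination (Nat.card V * (P : Subgroup (G α β γ)).index) * hnk
  have hco : Nat.Coprime (Nat.card Q) ((P : Subgroup (G α β γ)).index * k) := by
    rw [Sylow.card_eq_multiplicity]
    refine Nat.Coprime.pow_left _ ((Nat.Prime.coprime_iff_not_dvd hp).mpr fun h => ?_)
    exact (hp.dvd_mul.mp h).elim P.not_dvd_index hk
  exact hco.dvd_of_dvd_mul_right h2

/-- A Sylow `p`-subgroup of `W` is an extension of `P / N_p` by a cyclic group of order `p ^ n`. -/
theorem exists_sylow_extension (hγ : 0 < γ) [Finite (G α β γ)] [Group.IsNilpotent (G α β γ)]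
    {n k : ℕ} (hnk : γ = p ^ n * k) (hk : ¬ p ∣ k) (hid : ∀ g : P, π g = g)
    (hπ : ∀ g, (π g : G α β γ) = g ^ e) {μ : ℤ}
    (hμ : (QuotientGroup.mk (π (B α β γ)) : P ⧸ Np P) ^ (β * μ) = QuotientGroup.mk (π (B α β γ))) :
    ∃ (Q : Sylow p (W α β γ)) (ι : P ⧸ Np P →* Q) (d : Q), Function.Injective ι ∧ ι.range.Normal ∧
      rconj (ι (QuotientGroup.mk (π (A α β γ)))) d =
        ι (QuotientGroup.mk (π (A α β γ))) ^ (α ^ ((P : Subgroup (G α β γ)).index * k)) ∧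
      rconj (ι (QuotientGroup.mk (π (B α β γ)))) d =
        ι (QuotientGroup.mk (π (B α β γ))) ^ (μ ^ ((P : Subgroup (G α β γ)).index * k)) ∧
      d ^ p ^ n = comm (ι (QuotientGroup.mk (π (A α β γ)))) (ι (QuotientGroup.mk (π (B α β γ)))) ^
        (P : Subgroup (G α β γ)).index ∧
      (∀ t : Q, ∃ (x : P ⧸ Np P) (i : ℤ), t = ι x * d ^ i) ∧
      ∀ i : ℤ, d ^ i ∈ ι.range → ((p ^ n : ℕ) : ℤ) ∣ i := by
  have := finite_W (α := α) (β := β) hγ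
  have hp : p.Prime := Fact.out
  have hVn := normal_map_sylow hγ (fun g => ⟨g, hid g⟩) hπ
  set V := (P : Subgroup (G α β γ)).map (Omega α β γ) with hV
  have hPn : (P : Subgroup (G α β γ)).Normal := inferInstance
  set q := (P : Subgroup (G α β γ)).index with hq
  have hVp : IsPGroup p V := P.2.map _
  set D := Z α β γ ^ (q * k) with hD
  -- The left side is `Z^(γq)`, the image of `[A,B]^q`. That element lies in `P`, so raising it to
  -- the power `e` changes nothing.
  have hDpow : D ^ p ^ n = comm (X α β γ ^ e) (Y α β γ ^ e) ^ q := by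
    have h1 : comm (A α β γ) (B α β γ) ^ q ∈ P := Subgroup.pow_index_mem _ _
    have h2 := hπ (comm (A α β γ) (B α β γ) ^ q)
    rw [show π (comm (A α β γ) (B α β γ) ^ q) = ⟨_, h1⟩ from hid ⟨_, h1⟩] at h2
    have h3 := congrArg (Omega α β γ) h2
    simp only [map_pow, map_comm, Omega_A, Omega_B, ← Z_rel, ← pow_mul] at h3
    rw [comm_X_pow_Y_pow hπ, hD, ← pow_mul, ← pow_mul]
    convert h3 using 2
    · rw [hnk]; ring
    · ring
  have hDV : D ^ p ^ n ∈ V := by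
    rw [hDpow, ← Omega_projection_A hπ, ← Omega_projection_B hπ, ← map_comm, ← map_pow]
    refine ⟨_, ?_, rfl⟩
    exact Subgroup.pow_mem _ ((comm (π (A α β γ)) (π (B α β γ))).2) q
  have hDp : IsPGroup p (Subgroup.zpowers D) := by
    obtain ⟨m, hm⟩ := hVp ⟨_, hDV⟩
    have hm' : D ^ p ^ (n + m) = 1 := by
      rw [pow_add, pow_mul]
      exact congrArg Subtype.val hm
    obtain ⟨j, _, hj⟩ := (Nat.dvd_prime_pow hp).mp (orderOf_dvd_of_pow_eq_one hm')
    exact IsPGroup.of_card (n := j) (by rw [Nat.card_zpowers, hj])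
  obtain ⟨Q, hQ⟩ := hDp.exists_le_sylow
  have hVQ : V ≤ Q := hVp.le_sylow_of_normal Q
  let ω : P →* Q := ((Omega α β γ).comp (P : Subgroup (G α β γ)).subtype).codRestrict Q
    fun g => hVQ ⟨g, g.2, rfl⟩
  let ι : P ⧸ Np P →* Q := QuotientGroup.lift (Np P) ω fun g hg => Subtype.ext hg
  have hιa : (ι (QuotientGroup.mk (π (A α β γ))) : W α β γ) = X α β γ ^ e :=
    Omega_projection_A hπ
  have hιb : (ι (QuotientGroup.mk (π (B α β γ))) : W α β γ) = Y α β γ ^ e :=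
    Omega_projection_B hπ
  have hrange : ι.range = V.subgroupOf Q := by
    ext t
    rw [Subgroup.mem_subgroupOf, MonoidHom.mem_range]
    constructor
    · rintro ⟨x, rfl⟩
      obtain ⟨g, rfl⟩ := QuotientGroup.mk_surjective x
      exact ⟨g, g.2, rfl⟩
    · rintro ⟨g, hg, hgt⟩
      exact ⟨QuotientGroup.mk ⟨g, hg⟩, Subtype.ext hgt⟩
  have hnorm : ι.range.Normal := by rw [hrange]; infer_instance
  let d : Q := ⟨D, hQ (Subgroup.mem_zpowers D)⟩
  have hord : ∀ i : ℤ, d ^ i ∈ ι.range → ((p ^ n : ℕ) : ℤ) ∣ i := by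
    intro i hi
    rw [hrange, Subgroup.mem_subgroupOf] at hi
    have h1 : Z α β γ ^ (((q * k : ℕ) : ℤ) * i) ∈ (Omega α β γ).range := by
      rw [zpow_mul, zpow_natCast]
      exact Subgroup.map_le_range _ _ hi
    have h2 := dvd_of_Z_zpow_mem h1
    rw [hnk] at h2
    have hk0 : (k : ℤ) ≠ 0 := by
      intro h0; apply hk; rw [show k = 0 by exact_mod_cast h0]; exact dvd_zero p
    have h3 : ((p ^ n : ℕ) : ℤ) ∣ q * i := by
      obtain ⟨t, ht⟩ := h2
      refine ⟨t, mul_left_cancel₀ hk0 ?_⟩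
      push_cast at ht ⊢
      linear_combination ht
    have hco : IsCoprime ((p ^ n : ℕ) : ℤ) (q : ℤ) := Nat.isCoprime_iff_coprime.mpr
      (Nat.Coprime.pow_left n ((Nat.Prime.coprime_iff_not_dvd hp).mpr P.not_dvd_index))
    exact hco.dvd_of_dvd_mul_left h3
  have hindex : ι.range.index ∣ p ^ n := by
    have h1 := card_sylow_dvd (P := P) hγ hnk hk Q
    have h2 := Subgroup.card_mul_index (V.subgroupOf Q)
    rw [Nat.card_congr (Subgroup.subgroupOfEquivOfLe hVQ).toEquiv] at h2
    rw [hrange]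
    rw [← h2] at h1
    exact Nat.dvd_of_mul_dvd_mul_left Nat.card_pos h1
  refine ⟨Q, ι, d, ?_, hnorm, ?_, ?_, ?_, ?_, hord⟩
  · rw [injective_iff_map_eq_one]
    intro x hx
    obtain ⟨g, rfl⟩ := QuotientGroup.mk_surjective x
    exact (QuotientGroup.eq_one_iff g).mpr (congrArg Subtype.val hx)
  · have h1 := rconj_pow (rconj_X_pow (α := α) (β := β) (γ := γ) e) (q * k)
    rw [← hιa] at h1
    exact Subtype.ext h1
  · have h1 := rconj_pow (rconj_eq_zpow_of_lconj_eq (lconj_Y_pow e) (Y_pow_zpow_eq hπ hμ)) (q * k)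
    rw [← hιb] at h1
    exact Subtype.ext h1
  · rw [← hιa, ← hιb] at hDpow
    exact Subtype.ext hDpow
  -- The quotient has order dividing `p^n`, while by `hord` the order of `d` in it is a multiple of
  -- `p^n`.
  · have h1 : Subgroup.zpowers (QuotientGroup.mk d : Q ⧸ ι.range) = ⊤ := by
      apply Subgroup.eq_top_of_le_card
      rw [Nat.card_zpowers, ← Subgroup.index_eq_card]
      refine (Nat.le_of_dvd (pow_pos hp.pos n) hindex).trans (Nat.le_of_dvd (orderOf_pos _) ?_)
      have h2 := pow_orderOf_eq_one (QuotientGroup.mk d : Q ⧸ ι.range)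
      rw [← QuotientGroup.mk_pow, QuotientGroup.eq_one_iff, ← zpow_natCast] at h2
      exact_mod_cast hord _ h2
    intro t
    have h2 : (QuotientGroup.mk t : Q ⧸ ι.range) ∈
        Subgroup.zpowers (QuotientGroup.mk d : Q ⧸ ι.range) := h1 ▸ Subgroup.mem_top _
    obtain ⟨i, hi⟩ := h2
    have h3 : (QuotientGroup.mk (t * (d ^ i)⁻¹) : Q ⧸ ι.range) = 1 := by
      rw [QuotientGroup.mk_mul, QuotientGroup.mk_inv, QuotientGroup.mk_zpow, ← hi]
      exact mul_inv_cancel _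
    obtain ⟨x, hx⟩ := (QuotientGroup.eq_one_iff _).mp h3
    exact ⟨x, i, by rw [hx, inv_mul_cancel_right]⟩

/-- All Sylow `p`-subgroups of `W` have the structure given by `exists_sylow_extension`. -/
theorem sylow_extension (hγ : 0 < γ) [Finite (G α β γ)] [Group.IsNilpotent (G α β γ)]
    {n k : ℕ} (hnk : γ = p ^ n * k) (hk : ¬ p ∣ k) (hid : ∀ g : P, π g = g)
    (hπ : ∀ g, (π g : G α β γ) = g ^ e) {μ : ℤ}
    (hμ : (QuotientGroup.mk (π (B α β γ)) : P ⧸ Np P) ^ (β * μ) = QuotientGroup.mk (π (B α β γ)))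
    (Q : Sylow p (W α β γ)) :
    ∃ (ι : P ⧸ Np P →* Q) (d : Q), Function.Injective ι ∧ ι.range.Normal ∧
      rconj (ι (QuotientGroup.mk (π (A α β γ)))) d =
        ι (QuotientGroup.mk (π (A α β γ))) ^ (α ^ ((P : Subgroup (G α β γ)).index * k)) ∧
      rconj (ι (QuotientGroup.mk (π (B α β γ)))) d =
        ι (QuotientGroup.mk (π (B α β γ))) ^ (μ ^ ((P : Subgroup (G α β γ)).index * k)) ∧
      d ^ p ^ n = comm (ι (QuotientGroup.mk (π (A α β γ)))) (ι (QuotientGroup.mk (π (B α β γ)))) ^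
        (P : Subgroup (G α β γ)).index ∧
      (∀ t : Q, ∃ (x : P ⧸ Np P) (i : ℤ), t = ι x * d ^ i) ∧
      ∀ i : ℤ, d ^ i ∈ ι.range → ((p ^ n : ℕ) : ℤ) ∣ i := by
  have := finite_W (α := α) (β := β) hγ
  obtain ⟨Q₀, ι, d, h1, h2, h3, h4, h5, h6, h7⟩ := exists_sylow_extension hγ hnk hk hid hπ hμ
  let f : Q₀ ≃* Q := Q₀.equiv Q
  refine ⟨f.toMonoidHom.comp ι, f d, f.injective.comp h1, ?_, ?_, ?_, ?_, ?_, ?_⟩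
  · rw [MonoidHom.range_comp]
    exact h2.map _ f.surjective
  · have := congrArg f.toMonoidHom h3
    rwa [map_rconj, map_zpow] at this
  · have := congrArg f.toMonoidHom h4
    rwa [map_rconj, map_zpow] at this
  · have := congrArg f.toMonoidHom h5
    rwa [map_pow, map_pow, map_comm] at this
  · intro t
    obtain ⟨x, i, hxi⟩ := h6 (f.symm t)
    refine ⟨x, i, ?_⟩
    rw [← f.apply_symm_apply t, hxi, map_mul, map_zpow]; rfl
  · rintro i ⟨x, hx⟩
    refine h7 i ⟨x, f.injective ?_⟩
    rw [map_zpow]; exact hx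

end Concrete
end Wamsley
-- Assembly of the theorem
open Wamsley in
theorem theorem2p3 (α β : ℤ) (γ : ℕ) (hγ : 0 < γ) (hα : α ^ γ ≠ 1) (hβ : β ^ γ ≠ 1)
    (p n k : ℕ) (hp : p.Prime) (hpS : (p : ℤ) ∣ (α ^ γ - 1) * (β ^ γ - 1))
    (hnk : γ = p ^ n * k) (hk : ¬ p ∣ k) :
    Finite (G α β γ) ∧ Finite (W α β γ) ∧
    -- `β` is invertible modulo the order of `B`
    (∃ μ : ℤ, β * μ ≡ 1 [ZMOD (orderOf (B α β γ) : ℤ)]) ∧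
    -- `G` has only one Sylow `p`-subgroup `P = G_p`
    Subsingleton (Sylow p (G α β γ)) ∧
    ∀ P : Sylow p (G α β γ),
      -- the canonical projection `π : G → G_p` is the only retraction of `G` onto `G_p`
      ∃ π : G α β γ →* P, (∀ g : P, π g = g) ∧
        (∀ π' : G α β γ →* P, (∀ g : P, π' g = g) → π' = π) ∧
        let a : P := π (A α β γ)
        let b : P := π (B α β γ)
        let u : ℕ := orderOf a
        let v : ℕ := orderOf b
        let q : ℕ := Nat.card (G α β γ ⧸ (P : Subgroup (G α β γ)))
        let a₀ : P ⧸ Np P := QuotientGroup.mk a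
        let b₀ : P ⧸ Np P := QuotientGroup.mk b
        -- presentation of `G_p`
        IsPresentedBy ![a, b]
          (sylowRelators α β γ u v (FreeGroup.of (0 : Fin 2)) (FreeGroup.of (1 : Fin 2))) ∧
        (∀ μ : ℤ, β * μ ≡ 1 [ZMOD (orderOf b₀ : ℤ)] →
          -- `N_p` as a normal closure
          Np P = Subgroup.normalClosure (commElements α μ γ a b) ∧
          -- presentation of `G_p / N_p`
          IsPresentedBy ![a₀, b₀]
            (sylowRelators α β γ u v (FreeGroup.of (0 : Fin 2)) (FreeGroup.of (1 : Fin 2)) ∪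
              commElements α μ γ (FreeGroup.of (0 : Fin 2)) (FreeGroup.of (1 : Fin 2))) ∧
          -- every Sylow `p`-subgroup `Q = W_p` of `W`: normal embedding of `G_p / N_p`,
          -- cyclic quotient of order `p ^ n`, presentation
          ∀ Q : Sylow p (W α β γ), ∃ ι : (P ⧸ Np P) →* Q, Function.Injective ι ∧
            (∃ _ : ι.range.Normal, IsCyclic (Q ⧸ ι.range) ∧ Nat.card (Q ⧸ ι.range) = p ^ n) ∧
            ∃ d₀ : Q, IsPresentedBy ![ι a₀, ι b₀, d₀]
              (sylowRelators α β γ u v (FreeGroup.of (0 : Fin 3)) (FreeGroup.of (1 : Fin 3)) ∪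
                commElements α μ γ (FreeGroup.of (0 : Fin 3)) (FreeGroup.of (1 : Fin 3)) ∪
                extensionRelators α μ (q * k) (p ^ n) q
                  (FreeGroup.of (0 : Fin 3)) (FreeGroup.of (1 : Fin 3))
                  (FreeGroup.of (2 : Fin 3)))) ∧
        (∀ Q : Sylow p (W α β γ),
          (Nat.card Q : ℚ) = (p : ℚ) ^ n * (Nat.card P : ℚ) / (Nat.card (Np P) : ℚ)) ∧
        (¬ p ∣ γ → Subsingleton (Sylow p (W α β γ)) ∧
          ∀ Q : Sylow p (W α β γ), Nonempty ((P ⧸ Np P) ≃* Q)) := by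
  have : Fact p.Prime := ⟨hp⟩
  obtain ⟨hfin, hnil⟩ := finite_and_isNilpotent_G hα hβ
  have hfinW := finite_W (α := α) (β := β) hγ
  refine ⟨hfin, hfinW, ?_, ?_, fun P => ?_⟩
  · obtain ⟨t, k, hk⟩ := isCoprime_orderOf_B (α := α) (β := β) hγ
    exact ⟨t, Int.modEq_iff_dvd.mpr ⟨k, by linear_combination -hk⟩⟩
  · obtain ⟨P⟩ : Nonempty (Sylow p (G α β γ)) := inferInstance
    have := Sylow.unique_of_normal P inferInstance
    infer_instance
  obtain ⟨e, π, hπ, hep, heP⟩ := exists_sylow_projection P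
  have hpow (g : P) : g ^ e = g := by
    simpa using pow_eq_pow_of_modEq heP (pow_card_eq_one' (x := g))
  have hid (g : P) : π g = g := Subtype.ext (by rw [hπ]; exact congrArg Subtype.val (hpow g))
  refine ⟨π, hid, fun π' hπ' => ?_, ?_⟩
  · refine MonoidHom.ext fun g => ?_
    have h1 : π' (π g : G α β γ) = π' g := by rw [hπ, map_pow, hpow]
    rw [← h1, hπ']
  intro a b u v q a₀ b₀
  have hpres := isPresentedBy_sylow hα hβ (fun g => ⟨g, hid g⟩) hπ hep
  have hq : q = (P : Subgroup (G α β γ)).index := (Subgroup.index_eq_card _).symm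
  have hμ_of {μ : ℤ} (hμ : β * μ ≡ 1 [ZMOD (orderOf b₀ : ℤ)]) : b₀ ^ (β * μ) = b₀ := by
    simpa using zpow_eq_zpow_iff_modEq.mpr hμ
  -- The order formula and the final claim do not involve `μ`, so some inverse of `β` modulo the
  -- order of `b₀` is chosen for them.
  obtain ⟨ν, hν⟩ := exists_zpow_zpow_eq (isCoprime_orderOf_map
    (isCoprime_orderOf_B (α := α) (β := β) hγ) ((QuotientGroup.mk' (Np P)).comp π))
  rw [← zpow_mul] at hν
  have hcard (Q : Sylow p (W α β γ)) : Nat.card Q = p ^ n * Nat.card (P ⧸ Np P) := by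
    obtain ⟨ι, d, h1, h2, h3, h4, h5, h6, h7⟩ := sylow_extension hγ hnk hk hid hπ hν Q
    obtain ⟨_, h8⟩ := isCyclic_and_card_quotient_range ι d (p ^ n)
      (by rw [h5, ← map_comm, ← map_pow]; exact ⟨_, rfl⟩) h6 h7
    rw [Subgroup.card_eq_card_quotient_mul_card_subgroup ι.range, h8,
      Nat.card_congr (MonoidHom.ofInjective h1).toEquiv]
  refine ⟨hpres, fun μ hμ => ?_, fun Q => ?_, fun hpγ => ?_⟩
  · have hμ' := hμ_of hμ
    have hNp := Np_eq_normalClosure hγ hα hβ hid hπ hep hμ'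
    have hE : IsPresentedBy ![a₀, b₀]
        (sylowRelators α β γ u v (FreeGroup.of (0 : Fin 2)) (FreeGroup.of (1 : Fin 2)) ∪
          commElements α μ γ (FreeGroup.of (0 : Fin 2)) (FreeGroup.of (1 : Fin 2))) := by
      have h1 := hpres.quotient
        (commElements α μ γ (FreeGroup.of (0 : Fin 2)) (FreeGroup.of (1 : Fin 2))) (Np P)
        (by rw [image_commElements]; simpa using hNp)
      convert h1 using 1
      funext i; fin_cases i <;> rfl
    refine ⟨hNp, hE, fun Q => ?_⟩
    obtain ⟨ι, d, h1, h2, h3, h4, h5, h6, h7⟩ := sylow_extension hγ hnk hk hid hπ hμ' Q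
    refine ⟨ι, h1, ⟨h2, isCyclic_and_card_quotient_range ι d (p ^ n)
      (by rw [h5, ← map_comm, ← map_pow]; exact ⟨_, rfl⟩) h6 h7⟩, d, ?_⟩
    rw [hq]
    exact isPresentedBy_extension hE
      (isCoprime_orderOf_map (isCoprime_orderOf_A hγ) ((QuotientGroup.mk' (Np P)).comp π))
      (IsCoprime.of_zpow_mul_eq hμ') ι h1 d h3 h4 h5 h6 h7
  · have h0 : (Nat.card (Np P) : ℚ) ≠ 0 := by exact_mod_cast Nat.card_pos.ne'
    rw [hcard Q, Subgroup.card_eq_card_quotient_mul_card_subgroup (Np P)]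
    push_cast
    field_simp
  · have hn : n = 0 := by
      by_contra h0
      exact hpγ (hnk ▸ (dvd_pow_self p h0).mul_right k)
    subst hn
    have hVn := normal_map_sylow hγ (fun g => ⟨g, hid g⟩) hπ
    -- With `n = 0` the normal `p`-subgroup `Ω(P)` already has the order of a Sylow subgroup, so it
    -- is the only one.
    have hV (Q : Sylow p (W α β γ)) :
        (P : Subgroup (G α β γ)).map (Omega α β γ) = (Q : Subgroup (W α β γ)) :=
      Subgroup.eq_of_le_of_card_ge (IsPGroup.le_sylow_of_normal (P.2.map _) Q)
        (by rw [hcard Q, card_map_sylow, pow_zero, one_mul])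
    refine ⟨⟨fun Q Q' => Sylow.ext ((hV Q).symm.trans (hV Q'))⟩, fun Q => ?_⟩
    obtain ⟨ι, d, h1, -⟩ := sylow_extension hγ hnk hk hid hπ hν Q
    refine ⟨MulEquiv.ofBijective ι ((Nat.bijective_iff_injective_and_card ι).mpr ⟨h1, ?_⟩)⟩
    rw [hcard Q, pow_zero, one_mul]
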